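/- Let $\Bbbk$ be an algebraically closed field and let $Q$ be a finite quiver with $n$ vertices and no oriented cycles. All modules are finite-dimensional $\Bbbk Q$-modules. A module $M$ is rigid if $\mathrm{Ext}^1(M,M)=0$. Let $P_v$ be the indecomposable projective module at the vertex $v$. If $0\to\bigoplus_v P_v^{b_v}\to\bigoplus_v P_v^{a_v}\to M\to 0$ is a minimal projective presentation of $M$, then the $g$-vector of $M$ is $g(M)=(a_v-b_v)_v\in\mathbb{Z}^n$. The $g$-vector of a shifted projective $P_v[1]$ is $-e_v$. A silting pair $(T,P)$ consists of a rigid module $T=T_1\oplus\dots\oplus T_m$ with pairwise nonisomorphic indecomposable $T_i$ whose support has exactly $m$ vertices, and a module $P=P_{j_1}\oplus\dots\oplus P_{j_{n-m}}$, where $j_1,\dots,j_{n-m}$ are distinct vertices not in the support of $T$. Its components are $T_1,\dots,T_m,P_{j_1}[1],\dots,P_{j_{n-m}}[1]$, and the $g$-vectors of the components are the $g(T_i)$ and the $-e_{j_l}$. 1. Let $M$ be a rigid module and let $(T_i)_{i\in I}$ be a family of pairwise nonisomorphic indecomposable direct summands of $M$. Then the $g$-vectors $g(T_i)$ are linearly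 independent in $\mathbb{R}^n$, and the dimension vectors $\dim T_i$ are linearly independent in $\mathbb{R}^n$. In particular, $I$ is finite and $|I|\le n$. 2. Every silting pair has $n$ components, and their $g$-vectors are linearly independent. In particular they are affinely independent, so they are the vertices of an $(n-1)$-simplex. 3. These simplices do not overlap: for any two silting pairs, the intersection of the simplices spanned by the $g$-vectors of their components is the convex hull of the $g$-vectors of the common components of the two pairs (the components $T_i$ of the first that are isomorphic to a component of the second, and the common $P_j[1]$). Likewise, the intersection of the two convex cones generated by these $g$-vectors is the convex cone generated by the $g$-vectors of the common components. -/

import Mathlib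

universe u w

noncomputable section

/-- A path in the quiver `V`, bundled with its source and its target. -/
structure QuiverPath (V : Type u) [Quiver.{u} V] where
  source : V
  target : V
  path : Quiver.Path source target

/-- The underlying vector space of the path algebra `kQ`: the free `k`-module on the set of all
paths of the quiver `Q` (with set of vertices `V`), including the trivial paths. -/
def PathAlgebra (k : Type u) [Field k] (V : Type u) [Quiver.{u} V] : Type u :=
  QuiverPath V →₀ k

namespace PathAlgebra

variable (k : Type u) [Field k] {V : Type u} [Quiver.{u} V]

instance : AddCommGroup (PathAlgebra k V) :=
  inferInstanceAs (AddCommGroup (QuiverPath V →₀ k))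

instance : Module k (PathAlgebra k V) :=
  inferInstanceAs (Module k (QuiverPath V →₀ k))

/-- The paths form a basis of the path algebra. -/
def pathBasis : Module.Basis (QuiverPath V) k (PathAlgebra k V) :=
  Module.Basis.ofRepr (LinearEquiv.refl k (QuiverPath V →₀ k))

/-- The path `p`, as an element of the path algebra. -/
def ofPath (p : QuiverPath V) : PathAlgebra k V :=
  pathBasis k p

/-- The trivial path `e_v`, as an element of the path algebra. -/
def idem (v : V) : PathAlgebra k V :=
  ofPath k ⟨v, v, Quiver.Path.nil⟩

open Classical in
/-- The product `p * q` of two paths: first `q`, then `p`, if `q` ends where `p` starts, and `0`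
otherwise. With this convention left modules are covariant representations of the quiver. -/
def mulPath (p q : QuiverPath V) : PathAlgebra k V :=
  if h : q.target = p.source then
    ofPath k ⟨q.source, p.target, (q.path.cast rfl h).comp p.path⟩
  else 0

/-- The bilinear extension of the product of paths. -/
def mulHom : PathAlgebra k V →ₗ[k] PathAlgebra k V →ₗ[k] PathAlgebra k V :=
  (pathBasis k).constr k fun p => (pathBasis k).constr k fun q => mulPath k p q

instance : Mul (PathAlgebra k V) := ⟨fun a b => mulHom k a b⟩

instance [Fintype V] : One (PathAlgebra k V) := ⟨∑ v : V, idem k v⟩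

theorem mul_def (a b : PathAlgebra k V) : a * b = mulHom k a b := rfl

theorem one_def [Fintype V] : (1 : PathAlgebra k V) = ∑ v : V, idem k v := rfl

theorem ofPath_mul_ofPath (p q : QuiverPath V) : ofPath k p * ofPath k q = mulPath k p q := by
  rw [mul_def, mulHom, ofPath, ofPath, Module.Basis.constr_basis, Module.Basis.constr_basis]

theorem induction_on {P : PathAlgebra k V → Prop} (a : PathAlgebra k V) (h0 : P 0)
    (hadd : ∀ a b, P a → P b → P (a + b)) (hp : ∀ (c : k) p, P (c • ofPath k p)) : P a := by
  rw [← (pathBasis k).linearCombination_repr a, Finsupp.linearCombination_apply, Finsupp.sum]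
  exact Finset.sum_induction _ P hadd h0 fun p _ => hp _ p

theorem smul_mul' (c : k) (a b : PathAlgebra k V) : (c • a) * b = c • (a * b) := by
  simp [mul_def]

theorem mul_smul' (c : k) (a b : PathAlgebra k V) : a * (c • b) = c • (a * b) := by
  simp [mul_def]

instance : NonUnitalNonAssocRing (PathAlgebra k V) where
  left_distrib a b c := by simp [mul_def]
  right_distrib a b c := by simp [mul_def]
  zero_mul a := by simp [mul_def]
  mul_zero a := by simp [mul_def]

theorem ofPath_mul_assoc (p q r : QuiverPath V) :
    ofPath k p * ofPath k q * ofPath k r = ofPath k p * (ofPath k q * ofPath k r) := by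
  obtain ⟨ps, pt, p⟩ := p
  obtain ⟨qs, qt, q⟩ := q
  obtain ⟨rs, rt, r⟩ := r
  simp only [ofPath_mul_ofPath, mulPath]
  by_cases h1 : qt = ps
  · subst h1
    by_cases h2 : rt = qs
    · subst h2
      simp [ofPath_mul_ofPath, mulPath, Quiver.Path.comp_assoc]
    · simp [h2, ofPath_mul_ofPath, mulPath]
  · by_cases h2 : rt = qs
    · subst h2
      simp [h1, ofPath_mul_ofPath, mulPath]
    · simp [h1, h2]

theorem mul_assoc' (a b c : PathAlgebra k V) : a * b * c = a * (b * c) := by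
  refine induction_on k (P := fun a => a * b * c = a * (b * c)) a (by simp)
    (fun x y hx hy => by simp [add_mul, hx, hy]) fun s p => ?_
  refine induction_on k (P := fun b => s • ofPath k p * b * c = s • ofPath k p * (b * c)) b
    (by simp) (fun x y hx hy => by simp [add_mul, mul_add, hx, hy]) fun t q => ?_
  refine induction_on k (P := fun c => s • ofPath k p * t • ofPath k q * c =
    s • ofPath k p * (t • ofPath k q * c)) c
    (by simp) (fun x y hx hy => by simp [mul_add, hx, hy]) fun w r => ?_
  simp only [smul_mul', mul_smul', ofPath_mul_assoc]

theorem idem_mul_ofPath (v : V) (p : QuiverPath V) [Decidable (p.target = v)] :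
    idem k v * ofPath k p = if p.target = v then ofPath k p else 0 := by
  obtain ⟨s, t, p⟩ := p
  rw [idem, ofPath_mul_ofPath, mulPath]
  by_cases h : t = v
  · subst h; simp
  · simp [h]

theorem ofPath_mul_idem (v : V) (p : QuiverPath V) [Decidable (v = p.source)] :
    ofPath k p * idem k v = if v = p.source then ofPath k p else 0 := by
  obtain ⟨s, t, p⟩ := p
  rw [idem, ofPath_mul_ofPath, mulPath]
  by_cases h : v = s
  · subst h; simp
  · simp [h]

instance [Fintype V] : Ring (PathAlgebra k V) where
  mul_assoc := mul_assoc' k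
  one_mul a := by
    classical
    refine induction_on k (P := fun a => 1 * a = a) a (by simp)
      (fun x y hx hy => by rw [mul_add, hx, hy]) fun s p => ?_
    rw [mul_smul', one_def, Finset.sum_mul]
    simp [idem_mul_ofPath]
  mul_one a := by
    classical
    refine induction_on k (P := fun a => a * 1 = a) a (by simp)
      (fun x y hx hy => by rw [add_mul, hx, hy]) fun s p => ?_
    rw [smul_mul', one_def, Finset.mul_sum]
    simp [ofPath_mul_idem]

instance [Fintype V] : Algebra k (PathAlgebra k V) :=
  Algebra.ofModule (smul_mul' k) (fun c a b => mul_smul' k c a b)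

end PathAlgebra

section QuiverModules

open CategoryTheory Limits

/-- The quiver has no oriented cycles: every path from a vertex to itself is trivial. -/
def QuiverAcyclic (V : Type u) [Quiver.{u} V] : Prop :=
  ∀ (v : V) (p : Quiver.Path v v), p = Quiver.Path.nil

variable (k : Type u) [Field k] {V : Type u} [Quiver.{u} V] [Fintype V]

/-- The subspace `e_v M` of a `kQ`-module `M`, i.e. the vector space at the vertex `v` of the
corresponding representation. `RestrictScalars k _ M` is `M` with its underlying structure of
`k`-vector space. -/
def vertexSpace (M : ModuleCat.{u} (PathAlgebra k V)) (v : V) :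
    Submodule k (RestrictScalars k (PathAlgebra k V) M) :=
  LinearMap.range (RestrictScalars.lsmul k (PathAlgebra k V) M (PathAlgebra.idem k v))

/-- The dimension vector of a `kQ`-module. -/
def dimVector (M : ModuleCat.{u} (PathAlgebra k V)) (v : V) : ℕ :=
  Module.finrank k (vertexSpace k M v)

/-- The support of a `kQ`-module: the vertices with a nonzero vector space. -/
def moduleSupport (M : ModuleCat.{u} (PathAlgebra k V)) : Set V :=
  {v | vertexSpace k M v ≠ ⊥}

/-- The indecomposable projective `kQ`-module `P_v = kQ e_v`. -/
def vertexProjective (v : V) : Submodule (PathAlgebra k V) (PathAlgebra k V) :=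
  Submodule.span (PathAlgebra k V) {PathAlgebra.idem k v}

/-- The projective `kQ`-module in which each `P_v` occurs `a v` times as a direct summand. -/
abbrev projectiveSum (a : V → ℕ) : Type u :=
  ∀ v : V, Fin (a v) → vertexProjective k v

/-- `M` is the cokernel in a minimal projective presentation `0 → P' → P → M → 0`, with
`P' = ⊕ b_v P_v` and `P = ⊕ a_v P_v`, such that `g = a - b`. Minimality says that `π : P → M` is
a projective cover: the kernel of `π` is a superfluous submodule of `P`. -/
def IsGVector (M : ModuleCat.{u} (PathAlgebra k V)) (g : V → ℤ) : Prop :=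
  ∃ (a b : V → ℕ) (f : projectiveSum k b →ₗ[PathAlgebra k V] projectiveSum k a)
    (π : projectiveSum k a →ₗ[PathAlgebra k V] M),
    Function.Injective f ∧ Function.Exact f π ∧ Function.Surjective π ∧
      (∀ N : Submodule (PathAlgebra k V) (projectiveSum k a),
        N ⊔ LinearMap.ker π = ⊤ → N = ⊤) ∧
      ∀ v, g v = (a v : ℤ) - (b v : ℤ)

open Classical in
/-- The `g`-vector of a `kQ`-module (with value `0` if there is no presentation as above; for a
finite quiver without oriented cycles every finite-dimensional module has one). -/
def gVector (M : ModuleCat.{u} (PathAlgebra k V)) : V → ℤ :=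
  if h : ∃ g, IsGVector k M g then h.choose else 0

/-- A module is rigid if `Ext¹(M, M) = 0`. -/
def IsRigidModule (M : ModuleCat.{u} (PathAlgebra k V)) : Prop :=
  Subsingleton (Abelian.Ext M M 1)

/-- The family `T` consists of pairwise nonisomorphic indecomposable direct summands of `M`. -/
structure AreDistinctComponents {ι : Type*} (T : ι → ModuleCat.{u} (PathAlgebra k V))
    (M : ModuleCat.{u} (PathAlgebra k V)) : Prop where
  indecomposable : ∀ i, Indecomposable (T i)
  summand : ∀ i, ∃ N : ModuleCat.{u} (PathAlgebra k V), Nonempty (M ≅ T i ⊞ N)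
  pairwise_not_iso : ∀ i j, Nonempty (T i ≅ T j) → i = j

variable (V) in
/-- A silting pair `(T, P)`: a support tilting module `T = T_1 ⊕ ⋯ ⊕ T_m`, given by its
components, together with a projective module `P = ⊕_{j ∈ J} P_j` with `n - m` components, such
that no `j ∈ J` is in the support of `T`. -/
structure SiltingPair where
  /-- the number of components of `T` -/
  m : ℕ
  /-- the components of `T` -/
  T : Fin m → ModuleCat.{u} (PathAlgebra k V)
  /-- the vertices `j` for which `P_j` is a component of `P` -/
  J : Finset V
  finite : ∀ i, Module.Finite (PathAlgebra k V) (T i)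
  indecomposable : ∀ i, Indecomposable (T i)
  pairwise_not_iso : ∀ i j, Nonempty (T i ≅ T j) → i = j
  rigid : IsRigidModule k (ModuleCat.of (PathAlgebra k V) (∀ i, T i))
  card_support : (moduleSupport k (ModuleCat.of (PathAlgebra k V) (∀ i, T i))).ncard = m
  card_J : J.card + m = Fintype.card V
  not_mem_support : ∀ j ∈ J, j ∉ moduleSupport k (ModuleCat.of (PathAlgebra k V) (∀ i, T i))

/-- The `g`-vector of a module, as a vector in real space. -/
def realGVector (M : ModuleCat.{u} (PathAlgebra k V)) : V → ℝ :=
  fun v => (gVector k M v : ℝ)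

open Classical in
/-- The `g`-vector `-e_j` of the shifted projective `P_j[1]`, which has the projective
presentation `P_j → 0 → P_j[1]`. -/
def shiftedGVector (j : V) : V → ℝ :=
  -Pi.single j (1 : ℝ)

namespace SiltingPair

variable {k}

/-- The `g`-vectors of the components of a silting pair `(T, P)`: those of the components `T_i` of
`T`, and those of the shifted projectives `P_j[1]`, where `P_j` runs through the components of
`P`. -/
def gVectors (S : SiltingPair k V) : Fin S.m ⊕ S.J → V → ℝ :=
  Sum.elim (fun i => realGVector k (S.T i)) (fun j => shiftedGVector j.1)

/-- The `g`-vectors of the common components of two silting pairs. -/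
def commonGVectors (S S' : SiltingPair k V) : Set (V → ℝ) :=
  {x | (∃ i i', Nonempty (S.T i ≅ S'.T i') ∧ x = realGVector k (S.T i)) ∨
    ∃ j, j ∈ S.J ∧ j ∈ S'.J ∧ x = shiftedGVector j}

end SiltingPair

end QuiverModules

end

/-!
The path algebra of a finite acyclic quiver is finite-dimensional and hereditary: a submodule of
`P_v` is `P_v` itself or lies in the radical, which is the sum of the `P_w` over the arrows from `v`
to `w` (`PathAlgebra.hasProjectiveSubmodules_vertexProjective`). Hence every finitely generated
module has a minimal projective presentation by sums of the `P_v` (`PathAlgebra.exists_isGVector`),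
and `Ext¹(M, -)` is right exact. Applying `Hom(-, N)` to a presentation of `M` shows that the
pairing of the `g`-vector of `M` with the dimension vector of `N` is
`dim Hom(M, N) - dim Ext¹(M, N)` (`PathAlgebra.HasPresentation.exists_finrank_hom_eq`).

All assertions about `g`-vectors follow from one statement. Let
`x = ∑ c i • g (T i) - ∑ d v • e_v` with all `c i > 0` and all `d v ≥ 0`, where the `T i` have no
mutual extensions and `v` is outside their supports if `d v ≠ 0`. Then `x` determines the `T i` up
to isomorphism (`PathAlgebra.IsRigidCombination.exists_linearEquiv`), because it determines two
classes of modules by the signs of its pairings with dimension vectors: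

* `N` is generated by the `T i` if and only if `x` is positive on all nonzero quotients of `N`;
* `x` is nonnegative on all quotients of `N` if and only if `Ext¹(T i, N) = 0` for all `i` and `N`
  vanishes at all `v` with `d v ≠ 0`.

In both cases the quotient of `N` by the trace of the `T i` detects a failure: the `T i` have no
nonzero homomorphism to it, so `x` is nonpositive there. A module `T' j` from a second family with
the same `x` belongs to the first class, so it is the image of a sum of copies of the `T i` under a
right approximation. The kernel of the approximation belongs to the second class, so the
approximation splits, and since `T' j` has a local endomorphism ring it is isomorphic to some `T i`.

Separating the positive from the negative terms of a linear relation gives the linear independence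
of `g`-vectors (`PathAlgebra.eq_zero_of_sum_gVector_eq`). The dimension vector is the image of the
`g`-vector under the Cartan matrix, which is triangular with nonzero diagonal, so linear
independence of dimension vectors follows. Applied to a common point of two simplices or cones, the
statement shows that only common components have nonzero coefficients
(`SiltingPair.gVectors_mem_common`).
-/

noncomputable section

/-! ### Modules without extensions -/

section ExtVanish

variable (R : Type u) [Ring R]

/-- Vanishing of `Ext¹(X, N)`: for every projective module `P` mapping onto `X`, every homomorphism
from the kernel to `N` extends to `P`. -/
def ExtVanish (X N : Type u) [AddCommGroup X] [Module R X] [AddCommGroup N] [Module R N] : Prop :=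
  ∀ (P : Type u) [AddCommGroup P] [Module R P] [Module.Projective R P] (π : P →ₗ[R] X),
    Function.Surjective π → ∀ h : LinearMap.ker π →ₗ[R] N,
      ∃ H : P →ₗ[R] N, ∀ x : LinearMap.ker π, H x = h x

variable {R}
variable {X Y N N' N'' P K : Type u} [AddCommGroup X] [Module R X] [AddCommGroup Y] [Module R Y]
  [AddCommGroup N] [Module R N] [AddCommGroup N'] [Module R N'] [AddCommGroup N''] [Module R N'']
  [AddCommGroup P] [Module R P] [AddCommGroup K] [Module R K]

/-- The maps between kernels induced by a lift of the retraction differ from the identity by a map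
that extends to the projective module, so extendability passes to retracts and does not depend on
the presentation. -/
theorem ExtVanish.of_retract_of_presentation [Module.Projective R P] (i : X →ₗ[R] Y)
    (r : Y →ₗ[R] X) (hri : r ∘ₗ i = LinearMap.id) (π : P →ₗ[R] Y) (hπ : Function.Surjective π)
    (hext : ∀ h : LinearMap.ker π →ₗ[R] N, ∃ H : P →ₗ[R] N, ∀ x : LinearMap.ker π, H x = h x) :
    ExtVanish R X N := by
  intro Q _ _ _ ρ hρ h
  obtain ⟨ι, hι⟩ := Module.projective_lifting_property π (i ∘ₗ ρ) hπ
  obtain ⟨σ, hσ⟩ := Module.projective_lifting_property ρ (r ∘ₗ π) hρ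
  have hι' : ∀ x, π (ι x) = i (ρ x) := fun x => LinearMap.congr_fun hι x
  have hσ' : ∀ x, ρ (σ x) = r (π x) := fun x => LinearMap.congr_fun hσ x
  have hri' : ∀ x, r (i x) = x := fun x => LinearMap.congr_fun hri x
  have hσk : ∀ x : LinearMap.ker π, σ x ∈ LinearMap.ker ρ := fun x => by
    rw [LinearMap.mem_ker, hσ', LinearMap.mem_ker.1 x.2, map_zero]
  obtain ⟨H, hH⟩ := hext (h ∘ₗ (σ ∘ₗ (LinearMap.ker π).subtype).codRestrict _ hσk)
  have hd : ∀ x, (LinearMap.id - σ ∘ₗ ι : Q →ₗ[R] Q) x ∈ LinearMap.ker ρ := fun x => by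
    simp [hσ', hι', hri']
  refine ⟨H ∘ₗ ι + h ∘ₗ LinearMap.codRestrict _ _ hd, fun x => ?_⟩
  have hx : ι x ∈ LinearMap.ker π := by
    rw [LinearMap.mem_ker, hι', LinearMap.mem_ker.1 x.2, map_zero]
  have h1 := hH ⟨ι x, hx⟩
  simp only [LinearMap.add_apply, LinearMap.comp_apply] at h1 ⊢
  rw [h1, ← map_add]
  congr 1
  exact Subtype.ext (add_sub_cancel (σ (ι x)) (x : Q))

theorem ExtVanish.of_presentation [Module.Projective R P] (f : K →ₗ[R] P) (π : P →ₗ[R] X)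
    (hfπ : Function.Exact f π) (hπ : Function.Surjective π)
    (hext : ∀ h : K →ₗ[R] N, ∃ H : P →ₗ[R] N, H ∘ₗ f = h) : ExtVanish R X N := by
  refine ExtVanish.of_retract_of_presentation LinearMap.id LinearMap.id rfl π hπ fun h => ?_
  obtain ⟨H, hH⟩ := hext (h ∘ₗ f.codRestrict _ fun x => (hfπ (f x)).2 ⟨x, rfl⟩)
  refine ⟨H, fun x => ?_⟩
  obtain ⟨y, hy⟩ := (hfπ x).1 x.2
  have := LinearMap.congr_fun hH y
  simp only [LinearMap.comp_apply, hy] at this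
  rw [this]
  congr 1
  exact Subtype.ext hy

theorem ExtVanish.exists_extension [Module.Projective R P] (H : ExtVanish R X N) (f : K →ₗ[R] P)
    (π : P →ₗ[R] X) (hf : Function.Injective f) (hfπ : Function.Exact f π)
    (hπ : Function.Surjective π) (h : K →ₗ[R] N) : ∃ G : P →ₗ[R] N, G ∘ₗ f = h := by
  let e : K ≃ₗ[R] LinearMap.ker π :=
    (LinearEquiv.ofInjective f hf).trans
      (LinearEquiv.ofEq _ _ (LinearMap.exact_iff.1 hfπ).symm)
  obtain ⟨G, hG⟩ := H P π hπ (h ∘ₗ e.symm.toLinearMap)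
  refine ⟨G, LinearMap.ext fun x => ?_⟩
  have := hG (e x)
  simp only [LinearMap.comp_apply, LinearEquiv.coe_coe, LinearEquiv.symm_apply_apply] at this
  exact this

theorem ExtVanish.of_retract (H : ExtVanish R Y N) (i : X →ₗ[R] Y)
    (r : Y →ₗ[R] X) (hri : r ∘ₗ i = LinearMap.id) : ExtVanish R X N :=
  ExtVanish.of_retract_of_presentation (P := Y →₀ R) i r hri (Finsupp.linearCombination R id)
    (Finsupp.linearCombination_id_surjective R Y)
    (H _ _ (Finsupp.linearCombination_id_surjective R Y))

theorem ExtVanish.of_retract_right (H : ExtVanish R X N) (i : N' →ₗ[R] N)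
    (r : N →ₗ[R] N') (hri : r ∘ₗ i = LinearMap.id) : ExtVanish R X N' := by
  intro P _ _ _ π hπ h
  obtain ⟨G, hG⟩ := H P π hπ (i ∘ₗ h)
  refine ⟨r ∘ₗ G, fun x => ?_⟩
  rw [LinearMap.comp_apply, hG]
  exact LinearMap.congr_fun hri (h x)

theorem ExtVanish.pi {ι : Type} {W : ι → Type u} [∀ i, AddCommGroup (W i)]
    [∀ i, Module R (W i)] (H : ∀ i, ExtVanish R X (W i)) : ExtVanish R X (∀ i, W i) := by
  intro P _ _ _ π hπ h
  choose G hG using fun i => H i P π hπ (LinearMap.proj i ∘ₗ h)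
  exact ⟨LinearMap.pi G, fun x => funext fun i => hG i x⟩

/-- If `X` has projective dimension at most one, then `Ext¹(X, -)` is right exact. -/
theorem ExtVanish.of_surjective [Module.Projective R P] [Module.Projective R K]
    (f : K →ₗ[R] P) (π : P →ₗ[R] X) (hf : Function.Injective f) (hfπ : Function.Exact f π)
    (hπ : Function.Surjective π) (H : ExtVanish R X N) (q : N →ₗ[R] N')
    (hq : Function.Surjective q) : ExtVanish R X N' := by
  refine ExtVanish.of_presentation f π hfπ hπ fun h => ?_
  obtain ⟨h', hh'⟩ := Module.projective_lifting_property q h hq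
  obtain ⟨G, hG⟩ := H.exists_extension f π hf hfπ hπ h'
  exact ⟨q ∘ₗ G, by rw [LinearMap.comp_assoc, hG, hh']⟩

theorem ExtVanish.of_exact (i : N' →ₗ[R] N) (q : N →ₗ[R] N'') (hi : Function.Injective i)
    (hiq : Function.Exact i q) (hq : Function.Surjective q) (H' : ExtVanish R X N')
    (H'' : ExtVanish R X N'') : ExtVanish R X N := by
  intro P _ _ _ π hπ h
  obtain ⟨G, hG⟩ := H'' P π hπ (q ∘ₗ h)
  obtain ⟨G', hG'⟩ := Module.projective_lifting_property q G hq
  have hG'' : ∀ x, q (G' x) = G x := fun x => LinearMap.congr_fun hG' x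
  have hk : ∀ x, (h - G' ∘ₗ (LinearMap.ker π).subtype) x ∈ LinearMap.range i := fun x => by
    refine (hiq _).1 ?_
    simp [hG'', hG]
  let e := LinearEquiv.ofInjective i hi
  obtain ⟨L, hL⟩ := H' P π hπ (e.symm.toLinearMap ∘ₗ LinearMap.codRestrict _ _ hk)
  refine ⟨G' + i ∘ₗ L, fun x => ?_⟩
  have h2 : i (L x) = (e (L x) : N) := rfl
  rw [LinearMap.add_apply, LinearMap.comp_apply, h2, hL]
  simp

/-- If `Ext¹(X, N')` vanishes for the kernel `N'` of `N → N''`, then maps `X → N''` lift to `N`. -/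
theorem ExtVanish.exists_lift (i : N' →ₗ[R] N) (q : N →ₗ[R] N'') (hi : Function.Injective i)
    (hiq : Function.Exact i q) (hq : Function.Surjective q) (H' : ExtVanish R X N')
    (φ : X →ₗ[R] N'') : ∃ ψ : X →ₗ[R] N, q ∘ₗ ψ = φ := by
  let π : (X →₀ R) →ₗ[R] X := Finsupp.linearCombination R id
  have hπ : Function.Surjective π := Finsupp.linearCombination_id_surjective R X
  obtain ⟨G, hG⟩ := Module.projective_lifting_property q (φ ∘ₗ π) hq
  have hG' : ∀ x, q (G x) = φ (π x) := fun x => LinearMap.congr_fun hG x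
  have hk : ∀ x, (G ∘ₗ (LinearMap.ker π).subtype) x ∈ LinearMap.range i := fun x => by
    refine (hiq _).1 ?_
    simp [hG']
  let e := LinearEquiv.ofInjective i hi
  obtain ⟨L, hL⟩ := H' _ π hπ (e.symm.toLinearMap ∘ₗ LinearMap.codRestrict _ _ hk)
  have hLk : LinearMap.ker π ≤ LinearMap.ker (G - i ∘ₗ L) := fun x hx => by
    have h2 : i (L x) = (e (L x) : N) := rfl
    have h3 := hL ⟨x, hx⟩
    simp only at h3
    rw [LinearMap.mem_ker, LinearMap.sub_apply, LinearMap.comp_apply, h2, h3]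
    simp
  let s := π.quotKerEquivOfSurjective hπ
  refine ⟨(LinearMap.ker π).liftQ _ hLk ∘ₗ s.symm.toLinearMap, LinearMap.ext fun x => ?_⟩
  obtain ⟨y, rfl⟩ := hπ x
  have hs : s.symm (π y) = Submodule.Quotient.mk y := by
    rw [LinearEquiv.symm_apply_eq]; rfl
  simp only [LinearMap.comp_apply, LinearEquiv.coe_coe, hs]
  rw [← Submodule.mkQ_apply, Submodule.mkQ_apply, Submodule.liftQ_apply, LinearMap.sub_apply,
    map_sub, hG', LinearMap.comp_apply, (hiq (i (L y))).2 ⟨_, rfl⟩, sub_zero]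

/-- If `N → N''` stays surjective under `Hom(X, -)` and `Ext¹(X, N)` vanishes, then so does
`Ext¹(X, -)` of the kernel. -/
theorem ExtVanish.of_exact_of_surjective (i : N' →ₗ[R] N) (q : N →ₗ[R] N'')
    (hi : Function.Injective i) (hiq : Function.Exact i q) (H : ExtVanish R X N)
    (hlift : ∀ φ : X →ₗ[R] N'', ∃ ψ : X →ₗ[R] N, q ∘ₗ ψ = φ) : ExtVanish R X N' := by
  intro P _ _ _ π hπ h
  obtain ⟨G, hG⟩ := H P π hπ (i ∘ₗ h)
  have hk : LinearMap.ker π ≤ LinearMap.ker (q ∘ₗ G) := fun x hx => by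
    rw [LinearMap.mem_ker, LinearMap.comp_apply, hG ⟨x, hx⟩]
    exact (hiq _).2 ⟨_, rfl⟩
  let s := π.quotKerEquivOfSurjective hπ
  have hs : ∀ y, s.symm (π y) = Submodule.Quotient.mk y := fun y => by
    rw [LinearEquiv.symm_apply_eq]; rfl
  obtain ⟨ψ, hψ⟩ := hlift ((LinearMap.ker π).liftQ _ hk ∘ₗ s.symm.toLinearMap)
  have hψ' : ∀ y, q (ψ (π y)) = q (G y) := fun y => by
    have := LinearMap.congr_fun hψ (π y)
    simp only [LinearMap.comp_apply, LinearEquiv.coe_coe, hs] at this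
    rw [this, ← Submodule.mkQ_apply, Submodule.mkQ_apply, Submodule.liftQ_apply,
      LinearMap.comp_apply]
  have hr : ∀ y, (G - ψ ∘ₗ π) y ∈ LinearMap.range i := fun y => (hiq _).1 (by simp [hψ'])
  let e := LinearEquiv.ofInjective i hi
  refine ⟨e.symm.toLinearMap ∘ₗ LinearMap.codRestrict _ _ hr, fun x => ?_⟩
  rw [LinearMap.comp_apply, LinearEquiv.coe_coe, LinearEquiv.symm_apply_eq]
  ext
  have h2 : ((e (h x) : LinearMap.range i) : N) = i (h x) := rfl
  rw [h2, LinearMap.codRestrict_apply, LinearMap.sub_apply, hG, LinearMap.comp_apply,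
    LinearMap.comp_apply, LinearMap.mem_ker.1 x.2, map_zero, sub_zero]

end ExtVanish

/-! ### Rigid modules -/

section Rigid

open CategoryTheory

/-- The extension property follows from the long exact sequence of `Ext` in the first variable. -/
theorem ExtVanish.of_subsingleton_ext {R : Type u} [Ring R] {M N : ModuleCat.{u} R}
    (h : Subsingleton (Abelian.Ext M N 1)) : ExtVanish R M N := by
  intro P _ _ _ π hπ h
  let S : ShortComplex (ModuleCat.{u} R) :=
    ShortComplex.mk (ModuleCat.ofHom (LinearMap.ker π).subtype) (ModuleCat.ofHom π)
      (by ext x; exact x.2)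
  have hS : S.ShortExact :=
    { exact := (ShortComplex.moduleCat_exact_iff S).2 fun x hx => ⟨⟨x, hx⟩, rfl⟩
      mono_f := (ModuleCat.mono_iff_injective _).2 (Submodule.injective_subtype _)
      epi_g := (ModuleCat.epi_iff_surjective _).2 hπ }
  obtain ⟨x₂, hx₂⟩ := Abelian.Ext.contravariant_sequence_exact₁ hS N
    (Abelian.Ext.mk₀ (ModuleCat.ofHom h)) (n₁ := 1) rfl (Subsingleton.elim _ _)
  obtain ⟨G, rfl⟩ := (Abelian.Ext.mk₀_bijective _ _).2 x₂
  rw [Abelian.Ext.mk₀_comp_mk₀] at hx₂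
  have h3 := (Abelian.Ext.mk₀_bijective _ _).1 hx₂
  exact ⟨G.hom, fun x => congr($(h3).hom x)⟩

end Rigid

/-! ### Indecomposable modules of finite length -/

section Local

/-- A nonzero module that is not the internal direct sum of two nonzero submodules. -/
def IsIndecomposableModule (R : Type*) [Ring R] (X : Type*) [AddCommGroup X] [Module R X] : Prop :=
  Nontrivial X ∧ ∀ p q : Submodule R X, IsCompl p q → p = ⊥ ∨ q = ⊥

variable {R : Type*} [Ring R] {X Y : Type*} [AddCommGroup X] [Module R X]
  [AddCommGroup Y] [Module R Y]

namespace IsIndecomposableModule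

/-- Fitting's lemma. -/
theorem isNilpotent_or_isUnit [IsArtinian R X] [IsNoetherian R X]
    (hX : IsIndecomposableModule R X) (f : Module.End R X) : IsNilpotent f ∨ IsUnit f := by
  obtain ⟨n, hn⟩ := Filter.eventually_atTop.1 f.eventually_isCompl_ker_pow_range_pow
  have hc := hn (n + 1) n.le_succ
  rcases hX.2 _ _ hc with h | h
  · right
    have h1 : Function.Injective (f ^ (n + 1)) := LinearMap.ker_eq_bot.1 h
    have h2 : Function.Surjective (f ^ (n + 1)) := by
      rw [← LinearMap.range_eq_top]
      have := hc.sup_eq_top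
      rwa [h, bot_sup_eq] at this
    have h3 : IsUnit (f ^ (n + 1)) := (Module.End.isUnit_iff _).2 ⟨h1, h2⟩
    exact (isUnit_pow_iff n.succ_ne_zero).1 h3
  · exact Or.inl ⟨n + 1, LinearMap.range_eq_bot.1 h⟩

theorem isUnit_of_isUnit_add [IsArtinian R X] [IsNoetherian R X]
    (hX : IsIndecomposableModule R X) {f g : Module.End R X} (h : IsUnit (f + g)) :
    IsUnit f ∨ IsUnit g := by
  obtain ⟨u, hu⟩ := h
  have h1 : (↑u⁻¹ : Module.End R X) * f + ↑u⁻¹ * g = 1 := by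
    rw [← mul_add, ← hu, Units.inv_mul]
  rcases hX.isNilpotent_or_isUnit (↑u⁻¹ * f) with h2 | h2
  · right
    have h3 := h2.isUnit_one_sub
    rw [← h1, add_sub_cancel_left] at h3
    exact (Units.isUnit_units_mul _ _).1 h3
  · exact Or.inl ((Units.isUnit_units_mul _ _).1 h2)

theorem exists_isUnit_of_isUnit_sum [IsArtinian R X] [IsNoetherian R X]
    (hX : IsIndecomposableModule R X) {ι : Type*} (s : Finset ι) (f : ι → Module.End R X)
    (h : IsUnit (∑ i ∈ s, f i)) : ∃ i ∈ s, IsUnit (f i) := by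
  classical
  have := hX.1
  induction s using Finset.induction_on with
  | empty => simp at h
  | insert a s ha ih =>
    rw [Finset.sum_insert ha] at h
    rcases hX.isUnit_of_isUnit_add h with h | h
    · exact ⟨a, by simp, h⟩
    · obtain ⟨i, hi, hi'⟩ := ih h
      exact ⟨i, by simp [hi], hi'⟩

theorem nonempty_equiv_of_bijective_comp (hX : IsIndecomposableModule R X) [Nontrivial Y]
    (α : Y →ₗ[R] X) (β : X →ₗ[R] Y) (h : Function.Bijective (β ∘ₗ α)) :
    Nonempty (Y ≃ₗ[R] X) := by
  have hα : Function.Injective α := Function.Injective.of_comp h.1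
  have hβ : Function.Surjective β := Function.Surjective.of_comp h.2
  have hc : IsCompl (LinearMap.range α) (LinearMap.ker β) := by
    rw [isCompl_iff, Submodule.disjoint_def, codisjoint_iff, Submodule.eq_top_iff']
    constructor
    · rintro _ ⟨y, rfl⟩ hy
      have : (β ∘ₗ α) y = (β ∘ₗ α) 0 := by simpa using hy
      rw [h.1 this, map_zero]
    · intro x
      obtain ⟨y, hy⟩ := h.2 (β x)
      refine Submodule.mem_sup.2 ⟨α y, ⟨y, rfl⟩, x - α y, ?_, by abel⟩
      rw [LinearMap.mem_ker, map_sub, ← hy, LinearMap.comp_apply, sub_self]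
  rcases hX.2 _ _ hc with h0 | h0
  · obtain ⟨y, hy⟩ := exists_ne (0 : Y)
    refine absurd (hα ?_) hy
    rw [map_zero]
    exact (Submodule.eq_bot_iff _).1 h0 _ ⟨y, rfl⟩
  · exact ⟨(LinearEquiv.ofBijective β ⟨LinearMap.ker_eq_bot.1 h0, hβ⟩).symm⟩

/-- An indecomposable direct summand of a finite direct sum of indecomposables is isomorphic to one
of them. -/
theorem exists_equiv_of_retract_pi [IsArtinian R Y] [IsNoetherian R Y]
    (hY : IsIndecomposableModule R Y) {ι : Type*} [Fintype ι] {W : ι → Type*}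
    [∀ i, AddCommGroup (W i)] [∀ i, Module R (W i)] (hW : ∀ i, IsIndecomposableModule R (W i))
    (q : (∀ i, W i) →ₗ[R] Y) (s : Y →ₗ[R] ∀ i, W i) (hqs : q ∘ₗ s = LinearMap.id) :
    ∃ i, Nonempty (Y ≃ₗ[R] W i) := by
  classical
  have := hY.1
  let f : ι → Module.End R Y := fun i =>
    (q ∘ₗ LinearMap.single R W i) ∘ₗ (LinearMap.proj i ∘ₗ s)
  have hf : ∑ i, f i = 1 := by
    refine LinearMap.ext fun y => ?_
    rw [LinearMap.sum_apply]
    simp only [f, LinearMap.comp_apply, LinearMap.proj_apply, LinearMap.coe_single]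
    rw [← map_sum, LinearMap.sum_single_apply]
    exact LinearMap.congr_fun hqs y
  obtain ⟨i, -, hi⟩ := hY.exists_isUnit_of_isUnit_sum Finset.univ f (by rw [hf]; exact isUnit_one)
  exact ⟨i, (hW i).nonempty_equiv_of_bijective_comp _ _ ((Module.End.isUnit_iff _).1 hi)⟩

end IsIndecomposableModule

end Local

/-! ### Modules all of whose submodules are projective -/

section Hereditary

/-- All submodules of `M` are projective. -/
def HasProjectiveSubmodules (R : Type*) [Ring R] (M : Type*) [AddCommGroup M] [Module R M] :
    Prop :=
  ∀ U : Submodule R M, Module.Projective R U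

namespace HasProjectiveSubmodules

variable {R : Type*} [Ring R] {M N : Type*} [AddCommGroup M] [Module R M] [AddCommGroup N]
  [Module R N]

theorem of_injective (hN : HasProjectiveSubmodules R N) (f : M →ₗ[R] N)
    (hf : Function.Injective f) : HasProjectiveSubmodules R M := fun U => by
  have := hN (U.map f)
  exact Module.Projective.of_equiv (Submodule.equivMapOfInjective f hf U).symm

theorem prod (hM : HasProjectiveSubmodules R M) (hN : HasProjectiveSubmodules R N) :
    HasProjectiveSubmodules R (M × N) := fun U => by
  let p : U →ₗ[R] N := LinearMap.snd R M N ∘ₗ U.subtype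
  have := hN (LinearMap.range p)
  obtain ⟨s, hs⟩ := Module.projective_lifting_property p.rangeRestrict LinearMap.id
    p.surjective_rangeRestrict
  have hs' : ∀ x, p (s x) = x := fun x => congr_arg Subtype.val (LinearMap.congr_fun hs x)
  have : Module.Projective R (LinearMap.ker p) := by
    let j : LinearMap.ker p →ₗ[R] M :=
      LinearMap.fst R M N ∘ₗ U.subtype ∘ₗ (LinearMap.ker p).subtype
    have hj : Function.Injective j := by
      rintro ⟨⟨⟨m, n⟩, hx⟩, hx'⟩ ⟨⟨⟨m', n'⟩, hy⟩, hy'⟩ h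
      have h1 : n = 0 := hx'
      have h2 : n' = 0 := hy'
      have h3 : m = m' := h
      subst h1 h2 h3
      rfl
    have hk : HasProjectiveSubmodules R (LinearMap.ker p) := hM.of_injective j hj
    have := hk ⊤
    exact Module.Projective.of_equiv Submodule.topEquiv
  let e : (LinearMap.ker p × LinearMap.range p) →ₗ[R] U :=
    LinearMap.coprod (LinearMap.ker p).subtype s
  have hk : ∀ x, (LinearMap.id - s ∘ₗ p.rangeRestrict : U →ₗ[R] U) x ∈ LinearMap.ker p :=
    fun x => by simp [hs']
  let i : U →ₗ[R] (LinearMap.ker p × LinearMap.range p) :=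
    LinearMap.prod (LinearMap.codRestrict _ _ hk) p.rangeRestrict
  refine Module.Projective.of_split i e (LinearMap.ext fun x => ?_)
  simp [i, e]

theorem of_subsingleton [Subsingleton M] : HasProjectiveSubmodules R M := fun _ => inferInstance

theorem pi {ι : Type*} [Finite ι] : ∀ (W : ι → Type u) [∀ i, AddCommGroup (W i)]
    [∀ i, Module R (W i)], (∀ i, HasProjectiveSubmodules R (W i)) →
      HasProjectiveSubmodules R (∀ i, W i) := by
  induction ι using Finite.induction_empty_option with
  | of_equiv e h =>
    intro W _ _ hW
    exact (h (fun i => W (e i)) fun i => hW (e i)).of_injective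
      (LinearMap.pi fun i => LinearMap.proj (e i)) fun x y hxy => by
        funext i
        obtain ⟨j, rfl⟩ := e.surjective i
        exact congr_fun hxy j
  | h_empty => intro W _ _ hW; exact of_subsingleton
  | h_option h =>
    intro W _ _ hW
    refine ((hW none).prod (h (fun i => W (some i)) fun i => hW (some i))).of_injective
      (LinearMap.prod (LinearMap.proj none) (LinearMap.pi fun i => LinearMap.proj (some i))) ?_
    intro x y hxy
    funext i
    cases i with
    | none => exact congr_arg Prod.fst hxy
    | some i => exact congr_fun (congr_arg Prod.snd hxy) i

end HasProjectiveSubmodules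

end Hereditary

/-! ### Paths of an acyclic quiver -/

section Paths

variable {V : Type u} [Quiver.{u} V]

/-- `w` can be reached from `v` by a nontrivial path. -/
def ProperlyReachable (w v : V) : Prop :=
  ∃ p : Quiver.Path v w, p.length ≠ 0

theorem QuiverAcyclic.wellFounded [Finite V] (hV : QuiverAcyclic V) :
    WellFounded (ProperlyReachable (V := V)) := by
  have : IsTrans V ProperlyReachable := ⟨fun a b c ⟨p, hp⟩ ⟨q, hq⟩ => ⟨q.comp p, by
    rw [Quiver.Path.length_comp]; omega⟩⟩
  have : Std.Irrefl (ProperlyReachable (V := V)) := ⟨fun a ⟨p, hp⟩ => hp (by rw [hV a p]; rfl)⟩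
  exact Finite.wellFounded_of_trans_of_irrefl _

theorem QuiverAcyclic.wellFounded_flip [Finite V] (hV : QuiverAcyclic V) :
    WellFounded (flip (ProperlyReachable (V := V))) := by
  have : IsTrans V (flip ProperlyReachable) := ⟨fun a b c ⟨p, hp⟩ ⟨q, hq⟩ => ⟨p.comp q, by
    rw [Quiver.Path.length_comp]; omega⟩⟩
  have : Std.Irrefl (flip (ProperlyReachable (V := V))) :=
    ⟨fun a ⟨p, hp⟩ => hp (by rw [hV a p]; rfl)⟩
  exact Finite.wellFounded_of_trans_of_irrefl _

theorem properlyReachable_of_hom {v w : V} (e : v ⟶ w) : ProperlyReachable w v :=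
  ⟨e.toPath, by simp⟩

theorem exists_eq_toPath_comp {v t : V} (p : Quiver.Path v t) (hp : p.length ≠ 0) :
    ∃ (w : V) (e : v ⟶ w) (q : Quiver.Path w t), p = e.toPath.comp q := by
  obtain ⟨n, hn⟩ := Nat.exists_eq_succ_of_ne_zero hp
  obtain ⟨c, f, q, -, hq⟩ := Quiver.Path.eq_toPath_comp_of_length_eq_succ p hn
  exact ⟨c, f, q, hq⟩

theorem QuiverAcyclic.finite_quiverPath [Finite V] [∀ v w : V, Finite (v ⟶ w)]
    (hV : QuiverAcyclic V) : Finite (QuiverPath V) := by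
  have h : ∀ v : V, Finite (Σ t : V, Quiver.Path v t) := fun v => by
    induction v using hV.wellFounded.induction with
    | _ v ih =>
      have : ∀ a : (Σ w : V, (v ⟶ w)), Finite (Σ t : V, Quiver.Path a.1 t) :=
        fun a => ih a.1 (properlyReachable_of_hom a.2)
      let F : Option (Σ a : (Σ w : V, (v ⟶ w)), Σ t : V, Quiver.Path a.1 t) →
          Σ t : V, Quiver.Path v t :=
        fun o => o.elim ⟨v, .nil⟩ fun x => ⟨x.2.1, x.1.2.toPath.comp x.2.2⟩
      refine Finite.of_surjective F fun x => ?_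
      obtain ⟨t, p⟩ := x
      by_cases hp : p.length = 0
      · obtain rfl := p.eq_of_length_zero hp
        exact ⟨none, by rw [p.eq_nil_of_length_zero hp]; rfl⟩
      · obtain ⟨w, e, q, rfl⟩ := exists_eq_toPath_comp p hp
        exact ⟨some ⟨⟨w, e⟩, ⟨t, q⟩⟩, rfl⟩
  let F : (Σ v : V, Σ t : V, Quiver.Path v t) → QuiverPath V := fun x => ⟨x.1, x.2.1, x.2.2⟩
  exact Finite.of_surjective F fun p => ⟨⟨p.source, p.target, p.path⟩, rfl⟩

/-- A path of positive length determines its first arrow and the rest of the path. -/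
theorem toPath_comp_injective {v t : V} : ∀ {w w' : V} (e : v ⟶ w) (e' : v ⟶ w')
    (p : Quiver.Path w t) (p' : Quiver.Path w' t), e.toPath.comp p = e'.toPath.comp p' →
      (⟨⟨w, e⟩, p⟩ : Σ a : (Σ w : V, (v ⟶ w)), Quiver.Path a.1 t) = ⟨⟨w', e'⟩, p'⟩ := by
  intro w w' e e' p
  induction p with
  | nil =>
    intro p' h
    cases p' with
    | nil => cases h; rfl
    | cons q f =>
      have := congr_arg Quiver.Path.length h
      simp [Quiver.Path.length_comp] at this
  | cons q f ih =>
    intro p' h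
    cases p' with
    | nil =>
      have := congr_arg Quiver.Path.length h
      simp [Quiver.Path.length_comp] at this
    | cons q' f' =>
      rw [Quiver.Path.comp_cons, Quiver.Path.comp_cons] at h
      obtain rfl := Quiver.Path.obj_eq_of_cons_eq_cons h
      have h1 := eq_of_heq (Quiver.Path.heq_of_cons_eq_cons h)
      have h2 := eq_of_heq (Quiver.Path.hom_heq_of_cons_eq_cons h)
      cases ih q' h1
      cases h2
      rfl

end Paths

/-! ### The path algebra and the modules `P_v` -/

namespace PathAlgebra

variable {k : Type u} [Field k] {V : Type u} [Quiver.{u} V]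

/-- The coefficient of the path `p`. -/
def coeff (p : QuiverPath V) : PathAlgebra k V →ₗ[k] k :=
  (pathBasis k).coord p

open Classical in
theorem coeff_ofPath (p q : QuiverPath V) :
    coeff p (ofPath k q) = if q = p then 1 else 0 := by
  rw [coeff, ofPath, Module.Basis.coord_apply, Module.Basis.repr_self, Finsupp.single_apply]

theorem ext_coeff {x y : PathAlgebra k V} (h : ∀ p, coeff p x = coeff p y) : x = y :=
  (pathBasis k).ext_elem h

theorem sum_coeff (x : PathAlgebra k V) :
    x = ∑ p ∈ ((pathBasis k).repr x).support, coeff p x • ofPath k p :=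
  ((pathBasis k).linearCombination_repr x).symm

/-- Linear maps out of the path algebra agree if they agree on paths. -/
theorem linearMap_ext {M : Type*} [AddCommGroup M] [Module k M] {f g : PathAlgebra k V →ₗ[k] M}
    (h : ∀ p, f (ofPath k p) = g (ofPath k p)) : f = g :=
  (pathBasis k).ext h

/-- The trivial path at `v`. -/
abbrev trivialPath (v : V) : QuiverPath V := ⟨v, v, .nil⟩

theorem idem_mul_idem (v : V) : idem k v * idem k v = idem k v := by
  classical
  have := idem_mul_ofPath k v (trivialPath v)
  rwa [if_pos rfl] at this

theorem ofPath_mul_toPath {v w t : V} (e : v ⟶ w) (p : Quiver.Path w t) :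
    ofPath k ⟨w, t, p⟩ * ofPath k ⟨v, w, e.toPath⟩ = ofPath k ⟨v, t, e.toPath.comp p⟩ := by
  rw [ofPath_mul_ofPath, mulPath]
  simp

variable [Fintype V]

open Classical in
theorem coeff_mul_idem (p : QuiverPath V) (v : V) (x : PathAlgebra k V) :
    coeff p (x * idem k v) = if v = p.source then coeff p x else 0 := by
  have : coeff p ∘ₗ LinearMap.mulRight k (idem k v) =
      if v = p.source then coeff p else (0 : PathAlgebra k V →ₗ[k] k) := by
    refine linearMap_ext fun q => ?_
    rw [LinearMap.comp_apply, LinearMap.mulRight_apply, ofPath_mul_idem]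
    by_cases h : q = p
    · subst h; split_ifs <;> simp
    · split_ifs <;> simp [coeff_ofPath, h]
  have := LinearMap.congr_fun this x
  rw [LinearMap.comp_apply, LinearMap.mulRight_apply] at this
  rw [this]
  split_ifs <;> rfl

open Classical in
theorem coeff_idem_mul (p : QuiverPath V) (v : V) (x : PathAlgebra k V) :
    coeff p (idem k v * x) = if p.target = v then coeff p x else 0 := by
  have : coeff p ∘ₗ LinearMap.mulLeft k (idem k v) =
      if p.target = v then coeff p else (0 : PathAlgebra k V →ₗ[k] k) := by
    refine linearMap_ext fun q => ?_
    rw [LinearMap.comp_apply, LinearMap.mulLeft_apply, idem_mul_ofPath]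
    by_cases h : q = p
    · subst h; split_ifs <;> simp
    · split_ifs <;> simp [coeff_ofPath, h]
  have := LinearMap.congr_fun this x
  rw [LinearMap.comp_apply, LinearMap.mulLeft_apply] at this
  rw [this]
  split_ifs <;> rfl

theorem sum_idem : ∑ v : V, idem k v = 1 := (one_def k).symm

theorem mem_vertexProjective {v : V} {x : PathAlgebra k V} :
    x ∈ vertexProjective k v ↔ x * idem k v = x := by
  rw [vertexProjective, Submodule.mem_span_singleton]
  constructor
  · rintro ⟨a, rfl⟩
    rw [smul_eq_mul, mul_assoc, idem_mul_idem]
  · exact fun h => ⟨x, h⟩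

theorem idem_mem_vertexProjective (v : V) : idem k v ∈ vertexProjective k v :=
  mem_vertexProjective.2 (idem_mul_idem v)

/-- Right multiplication by `e_v`, as a projection of the path algebra onto `P_v`. -/
def mulIdem (k : Type u) [Field k] (v : V) :
    PathAlgebra k V →ₗ[PathAlgebra k V] vertexProjective k v :=
  (LinearMap.toSpanSingleton (PathAlgebra k V) (PathAlgebra k V) (idem k v)).codRestrict _
    fun x => by
      rw [LinearMap.toSpanSingleton_apply, smul_eq_mul, mem_vertexProjective, mul_assoc,
        idem_mul_idem]

theorem coe_mulIdem (v : V) (x : PathAlgebra k V) :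
    (mulIdem k v x : PathAlgebra k V) = x * idem k v := rfl

instance projective_vertexProjective (v : V) :
    Module.Projective (PathAlgebra k V) (vertexProjective k v) := by
  refine Module.Projective.of_split (vertexProjective k v).subtype (mulIdem k v)
    (LinearMap.ext fun x => Subtype.ext ?_)
  rw [LinearMap.comp_apply, coe_mulIdem, Submodule.subtype_apply, mem_vertexProjective.1 x.2,
    LinearMap.id_apply]

theorem source_eq_of_coeff_ne_zero {v : V} {x : PathAlgebra k V} (hx : x ∈ vertexProjective k v)
    {p : QuiverPath V} (hp : coeff p x ≠ 0) : v = p.source := by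
  classical
  rw [← mem_vertexProjective.1 hx, coeff_mul_idem] at hp
  by_contra h
  simp [h] at hp

/-- For an acyclic quiver, `e_v P_v` is spanned by `e_v`. -/
theorem idem_mul_eq_coeff_smul (hV : QuiverAcyclic V) {v : V} {x : PathAlgebra k V}
    (hx : x ∈ vertexProjective k v) : idem k v * x = coeff (trivialPath v) x • idem k v := by
  classical
  refine ext_coeff fun p => ?_
  rw [coeff_idem_mul, map_smul, idem, coeff_ofPath]
  obtain ⟨s, t, p⟩ := p
  by_cases h : t = v
  · subst h
    by_cases hs : t = s
    · subst hs
      rw [hV t p]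
      simp
    · have h0 : coeff ⟨s, t, p⟩ x = 0 := by
        by_contra h
        exact hs (source_eq_of_coeff_ne_zero hx h)
      have h1 : ¬ (⟨t, t, .nil⟩ : QuiverPath V) = ⟨s, t, p⟩ :=
        fun h => hs (congr_arg QuiverPath.source h)
      simp [h0, h1]
  · have h1 : ¬ (⟨v, v, .nil⟩ : QuiverPath V) = ⟨s, t, p⟩ :=
      fun hh => h (congr_arg QuiverPath.target hh).symm
    simp [h, h1]

open Classical in
theorem coeff_toPath_comp {v w w' t : V} (e : v ⟶ w) (e' : v ⟶ w') (p : Quiver.Path w t)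
    {x : PathAlgebra k V} (hx : x ∈ vertexProjective k w') :
    coeff ⟨v, t, e.toPath.comp p⟩ (x * ofPath k ⟨v, w', e'.toPath⟩) =
      if (⟨w, e⟩ : Σ w : V, (v ⟶ w)) = ⟨w', e'⟩ then coeff ⟨w, t, p⟩ x else 0 := by
  have : coeff ⟨v, t, e.toPath.comp p⟩ ∘ₗ LinearMap.mulRight k (ofPath k ⟨v, w', e'.toPath⟩) =
      if (⟨w, e⟩ : Σ w : V, (v ⟶ w)) = ⟨w', e'⟩ then coeff ⟨w, t, p⟩
        else (0 : PathAlgebra k V →ₗ[k] k) := by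
    refine linearMap_ext fun q => ?_
    obtain ⟨s, t', q⟩ := q
    rw [LinearMap.comp_apply, LinearMap.mulRight_apply]
    by_cases hs : w' = s
    · subst hs
      rw [ofPath_mul_toPath, coeff_ofPath]
      split_ifs with h1 h2 h2
      · cases h2
        have h3 : t' = t := congr_arg QuiverPath.target h1
        subst h3
        injection h1 with _ _ h4
        have h6 := toPath_comp_injective _ _ _ _ h4
        have h7 : q = p := by simpa using h6
        subst h7
        simp [coeff_ofPath]
      · exfalso
        have h3 : t' = t := congr_arg QuiverPath.target h1
        subst h3
        injection h1 with _ _ h4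
        exact h2 (congrArg Sigma.fst (toPath_comp_injective _ _ _ _ h4)).symm
      · cases h2
        rw [coeff_ofPath, if_neg]
        intro h5
        cases h5
        exact h1 rfl
      · simp
    · rw [ofPath_mul_ofPath, mulPath, dif_neg hs, map_zero]
      split_ifs with h2
      · cases h2
        rw [coeff_ofPath, if_neg]
        intro h
        exact hs (congr_arg QuiverPath.source h).symm
      · rfl
  have := LinearMap.congr_fun this x
  rw [LinearMap.comp_apply, LinearMap.mulRight_apply] at this
  rw [this]
  split_ifs <;> rfl

/-! ### The path algebra of an acyclic quiver is hereditary -/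

section Radical

/-- Right multiplication by the arrows starting at `v`, from the sum of the `P_w` over all arrows
`v ⟶ w` to `P_v`. Its image is the radical of `P_v`. -/
def arrowMap (k : Type u) [Field k] [∀ v w : V, Finite (v ⟶ w)] (v : V) :
    (∀ a : (Σ w : V, (v ⟶ w)), vertexProjective k a.1) →ₗ[PathAlgebra k V]
      vertexProjective k v :=
  letI := Fintype.ofFinite (Σ w : V, (v ⟶ w))
  ∑ a : (Σ w : V, (v ⟶ w)),
    (((LinearMap.toSpanSingleton (PathAlgebra k V) (PathAlgebra k V)
      (ofPath k ⟨v, a.1, a.2.toPath⟩)).restrict (p := vertexProjective k a.1)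
        (q := vertexProjective k v) fun x _ => by
          classical
          rw [LinearMap.toSpanSingleton_apply, smul_eq_mul, mem_vertexProjective, mul_assoc,
            ofPath_mul_idem]
          simp) ∘ₗ LinearMap.proj a)

variable [∀ v w : V, Finite (v ⟶ w)]

theorem coe_arrowMap {v : V} [Fintype (Σ w : V, (v ⟶ w))]
    (x : ∀ a : (Σ w : V, (v ⟶ w)), vertexProjective k a.1) :
    (arrowMap k v x : PathAlgebra k V) =
      ∑ a, (x a : PathAlgebra k V) * ofPath k ⟨v, a.1, a.2.toPath⟩ := by
  rw [arrowMap, LinearMap.sum_apply, Submodule.coe_sum]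
  refine Finset.sum_congr (by congr!) fun a _ => rfl

theorem arrowMap_injective (v : V) : Function.Injective (arrowMap k v) := by
  classical
  let := Fintype.ofFinite (Σ w : V, (v ⟶ w))
  refine (injective_iff_map_eq_zero _).2 fun x hx => ?_
  have h0 := congr_arg Subtype.val hx
  rw [coe_arrowMap] at h0
  funext a
  refine Subtype.ext (ext_coeff fun p => ?_)
  obtain ⟨w, e⟩ := a
  obtain ⟨s, t, p⟩ := p
  by_cases hs : w = s
  · subst hs
    have h1 := congr_arg (coeff ⟨v, t, e.toPath.comp p⟩) h0
    rw [map_sum] at h1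
    have h2 : ∀ a : (Σ w : V, (v ⟶ w)), coeff ⟨v, t, e.toPath.comp p⟩
        ((x a : PathAlgebra k V) * ofPath k ⟨v, a.1, a.2.toPath⟩) =
          if (⟨w, e⟩ : Σ w : V, (v ⟶ w)) = a then
            coeff ⟨w, t, p⟩ (x ⟨w, e⟩ : PathAlgebra k V) else 0 := by
      rintro ⟨w', e'⟩
      rw [coeff_toPath_comp e e' p (x ⟨w', e'⟩).2]
      split_ifs with h
      · rw [h]
      · rfl
    rw [Finset.sum_congr rfl fun a _ => h2 a, Finset.sum_ite_eq] at h1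
    simpa using h1
  · have : ∀ y : PathAlgebra k V, y ∈ vertexProjective k w → coeff ⟨s, t, p⟩ y = 0 := by
      intro y hy
      by_contra h
      exact hs (source_eq_of_coeff_ne_zero hy h)
    rw [this _ (x ⟨w, e⟩).2]
    simp

theorem mem_range_arrowMap {v : V} (x : vertexProjective k v)
    (hx : coeff (trivialPath v) (x : PathAlgebra k V) = 0) :
    x ∈ LinearMap.range (arrowMap k v) := by
  classical
  let := Fintype.ofFinite (Σ w : V, (v ⟶ w))
  suffices h : (x : PathAlgebra k V) ∈
      (LinearMap.range (arrowMap k v)).map (vertexProjective k v).subtype by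
    obtain ⟨y, hy, hxy⟩ := h
    rwa [← Subtype.ext hxy]
  rw [sum_coeff (x : PathAlgebra k V)]
  refine Submodule.sum_mem _ fun p _ => ?_
  by_cases hp : coeff p (x : PathAlgebra k V) = 0
  · rw [hp, zero_smul]; exact Submodule.zero_mem _
  rw [← algebraMap_smul (PathAlgebra k V)]
  refine Submodule.smul_mem _ _ ?_
  obtain rfl := source_eq_of_coeff_ne_zero x.2 hp
  obtain ⟨v, t, p⟩ := p
  have hl : p.length ≠ 0 := fun h => by
    obtain rfl := p.eq_of_length_zero h
    rw [p.eq_nil_of_length_zero h] at hp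
    exact hp hx
  obtain ⟨w, e, q, rfl⟩ := exists_eq_toPath_comp p hl
  have hq : ofPath k ⟨w, t, q⟩ ∈ vertexProjective k w := by
    rw [mem_vertexProjective, ofPath_mul_idem]
    simp
  refine ⟨_, ⟨Pi.single ⟨w, e⟩ ⟨_, hq⟩, rfl⟩, ?_⟩
  rw [Submodule.subtype_apply, coe_arrowMap, Finset.sum_eq_single ⟨w, e⟩]
  · rw [Pi.single_eq_same]
    exact ofPath_mul_toPath e q
  · intro b _ hb
    rw [Pi.single_eq_of_ne hb]
    simp
  · simp

/-- A submodule of `P_v` is either `P_v` or contained in the radical, which is a sum of modules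
`P_w` with `w` properly reachable from `v`. -/
theorem hasProjectiveSubmodules_vertexProjective (hV : QuiverAcyclic V) (v : V) :
    HasProjectiveSubmodules (PathAlgebra k V) (vertexProjective k v) := by
  induction v using hV.wellFounded.induction with
  | _ v ih =>
    intro U
    by_cases hU : ∀ x ∈ U, coeff (trivialPath v) (x : PathAlgebra k V) = 0
    · have h1 : HasProjectiveSubmodules (PathAlgebra k V)
          (∀ a : (Σ w : V, (v ⟶ w)), vertexProjective k a.1) :=
        HasProjectiveSubmodules.pi _ fun a => ih a.1 (properlyReachable_of_hom a.2)
      let e := LinearEquiv.ofInjective (arrowMap k v) (arrowMap_injective v)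
      have h2 : HasProjectiveSubmodules (PathAlgebra k V) (LinearMap.range (arrowMap k v)) :=
        h1.of_injective e.symm.toLinearMap e.symm.injective
      have h3 : U ≤ LinearMap.range (arrowMap k v) := fun x hx => mem_range_arrowMap x (hU x hx)
      have h4 := h2.of_injective (Submodule.inclusion h3) (Submodule.inclusion_injective h3) ⊤
      exact Module.Projective.of_equiv Submodule.topEquiv
    · push Not at hU
      obtain ⟨x, hx, hx0⟩ := hU
      -- Multiplying `x` by a multiple of `e_v` recovers the generator `e_v` of `P_v`.
      have hmem : (⟨idem k v, idem_mem_vertexProjective v⟩ : vertexProjective k v) ∈ U := by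
        have h1 : (algebraMap k (PathAlgebra k V) (coeff (trivialPath v) (x : PathAlgebra k V))⁻¹ *
            idem k v) • x ∈ U := U.smul_mem _ hx
        convert h1
        rw [Submodule.coe_smul, smul_eq_mul, mul_assoc, idem_mul_eq_coeff_smul hV x.2,
          ← Algebra.smul_def, smul_smul, inv_mul_cancel₀ hx0, one_smul]
      have htop : U = ⊤ := by
        refine (Submodule.eq_top_iff').2 fun y => ?_
        have h1 := U.smul_mem (y : PathAlgebra k V) hmem
        rwa [show (y : PathAlgebra k V) • (⟨idem k v, idem_mem_vertexProjective v⟩ :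
          vertexProjective k v) = y from Subtype.ext (mem_vertexProjective.1 y.2)] at h1
      subst htop
      exact Module.Projective.of_equiv Submodule.topEquiv.symm

end Radical

end PathAlgebra

namespace PathAlgebra

/-! ### Projective covers -/

section ProjectiveCover

variable {k : Type u} [Field k] {V : Type u} [Quiver.{u} V] [Fintype V]

instance projective_projectiveSum (a : V → ℕ) :
    Module.Projective (PathAlgebra k V) (projectiveSum k a) := by
  classical
  have : ∀ v, Module.Projective (PathAlgebra k V) (Fin (a v) → vertexProjective k v) := fun v =>
    Module.Projective.of_equiv (DFinsupp.linearEquivFunOnFintype (R := PathAlgebra k V)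
      (M := fun _ : Fin (a v) => vertexProjective k v))
  exact Module.Projective.of_equiv (DFinsupp.linearEquivFunOnFintype (R := PathAlgebra k V)
    (M := fun v => Fin (a v) → vertexProjective k v))

theorem hasProjectiveSubmodules_projectiveSum [∀ v w : V, Finite (v ⟶ w)] (hV : QuiverAcyclic V)
    (a : V → ℕ) : HasProjectiveSubmodules (PathAlgebra k V) (projectiveSum k a) :=
  HasProjectiveSubmodules.pi _ fun v => HasProjectiveSubmodules.pi _ fun _ =>
    hasProjectiveSubmodules_vertexProjective hV v

variable {M : Type u} [AddCommGroup M] [Module (PathAlgebra k V) M]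

/-- The homomorphism that sends the generator of the `i`-th copy of `P_v` to `e_v • m v i`. -/
def generatorMap {a : V → ℕ} (m : ∀ v, Fin (a v) → M) :
    projectiveSum k a →ₗ[PathAlgebra k V] M :=
  ∑ v, ∑ i, LinearMap.toSpanSingleton (PathAlgebra k V) M (m v i) ∘ₗ
    (vertexProjective k v).subtype ∘ₗ LinearMap.proj i ∘ₗ LinearMap.proj v

theorem generatorMap_apply {a : V → ℕ} (m : ∀ v, Fin (a v) → M) (x : projectiveSum k a) :
    generatorMap m x = ∑ v, ∑ i, (x v i : PathAlgebra k V) • m v i := by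
  simp only [generatorMap, LinearMap.sum_apply]
  rfl

open Classical in
/-- The generator of the `i`-th copy of `P_v`. -/
def generator {a : V → ℕ} (v : V) (i : Fin (a v)) : projectiveSum k a :=
  Pi.single v (Pi.single i ⟨idem k v, idem_mem_vertexProjective v⟩)

theorem eq_sum_smul_generator {a : V → ℕ} (x : projectiveSum k a) :
    x = ∑ v, ∑ i, (x v i : PathAlgebra k V) • generator v i := by
  classical
  have h : ∀ v i, (x v i : PathAlgebra k V) • (generator v i : projectiveSum k a) =
      Pi.single v (Pi.single i (x v i)) := fun v i => by
    have h1 : (x v i : PathAlgebra k V) • (⟨idem k v, idem_mem_vertexProjective v⟩ :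
        vertexProjective k v) = x v i := Subtype.ext (mem_vertexProjective.1 (x v i).2)
    rw [generator, ← Pi.single_smul, ← Pi.single_smul, h1]
  simp only [h]
  conv_lhs => rw [← Finset.univ_sum_single x]
  refine Finset.sum_congr rfl fun v _ => ?_
  conv_lhs => rw [← Finset.univ_sum_single (x v)]
  exact map_sum (AddMonoidHom.single (fun v => Fin (a v) → vertexProjective k v) v) _ _

theorem generatorMap_generator {a : V → ℕ} (m : ∀ v, Fin (a v) → M) (v : V) (i : Fin (a v)) :
    generatorMap m (generator v i : projectiveSum k a) = idem k v • m v i := by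
  classical
  rw [generatorMap_apply, Finset.sum_eq_single v, Finset.sum_eq_single i]
  · simp only [generator, Pi.single_eq_same]
  · intro j _ hj
    simp only [generator, Pi.single_eq_same, Pi.single_eq_of_ne hj, Submodule.coe_zero, zero_smul]
  · simp
  · intro w _ hw
    simp only [generator, Pi.single_eq_of_ne hw, Pi.zero_apply, Submodule.coe_zero, zero_smul,
      Finset.sum_const_zero]
  · simp

theorem idem_smul_generator {a : V → ℕ} (v : V) (i : Fin (a v)) :
    idem k v • (generator v i : projectiveSum k a) = generator v i := by
  classical
  rw [generator, ← Pi.single_smul, ← Pi.single_smul]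
  congr 2
  exact Subtype.ext (idem_mul_idem v)

/-- A submodule of `⊕ P_v^{a_v}` all of whose elements have coefficient `0` at the trivial paths is
contained in the radical, hence superfluous. -/
theorem eq_top_of_sup_eq_top (hV : QuiverAcyclic V) {a : V → ℕ}
    {N K : Submodule (PathAlgebra k V) (projectiveSum k a)}
    (hK : ∀ x ∈ K, ∀ v i, coeff (trivialPath v) (x v i : PathAlgebra k V) = 0)
    (hNK : N ⊔ K = ⊤) : N = ⊤ := by
  classical
  have key : ∀ v i, generator v i ∈ N := fun v => by
    induction v using hV.wellFounded_flip.induction with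
    | _ v ih =>
      intro i
      obtain ⟨n, hn, r, hr, hnr⟩ := Submodule.mem_sup.1
        (hNK ▸ Submodule.mem_top : generator v i ∈ N ⊔ K)
      rw [← idem_smul_generator, ← hnr, smul_add]
      refine N.add_mem (N.smul_mem _ hn) ?_
      rw [eq_sum_smul_generator r, Finset.smul_sum]
      refine N.sum_mem fun w _ => ?_
      rw [Finset.smul_sum]
      refine N.sum_mem fun j _ => ?_
      rw [smul_smul]
      by_cases hwv : ProperlyReachable v w
      · exact N.smul_mem _ (ih w hwv j)
      · have h0 : idem k v * (r w j : PathAlgebra k V) = 0 := by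
          by_cases hvw : v = w
          · subst hvw
            rw [idem_mul_eq_coeff_smul hV (r v j).2, hK r hr, zero_smul]
          · refine ext_coeff fun p => ?_
            rw [coeff_idem_mul, map_zero]
            split_ifs with hp
            · by_contra hc
              have hs := source_eq_of_coeff_ne_zero (r w j).2 hc
              obtain ⟨s, t, p⟩ := p
              subst hs hp
              exact hwv ⟨p, fun h => hvw (p.eq_of_length_zero h).symm⟩
            · rfl
        rw [h0, zero_smul]
        exact N.zero_mem
  refine Submodule.eq_top_iff'.2 fun x => ?_
  rw [eq_sum_smul_generator x]
  exact N.sum_mem fun v _ => N.sum_mem fun i _ => N.smul_mem _ (key v i)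

/-- Every finitely generated module has a projective cover: the one given by a generating set of
minimal cardinality that consists of elements of the spaces `e_v M`. -/
theorem exists_projectiveCover (hV : QuiverAcyclic V) [Module.Finite (PathAlgebra k V) M] :
    ∃ (a : V → ℕ) (π : projectiveSum k a →ₗ[PathAlgebra k V] M), Function.Surjective π ∧
      ∀ N : Submodule (PathAlgebra k V) (projectiveSum k a),
        N ⊔ LinearMap.ker π = ⊤ → N = ⊤ := by
  classical
  -- A pair `(v, m)` stands for the element `e_v m` of `e_v M`.
  let gen : Finset (V × M) → Set M := fun s => (fun x : V × M => idem k x.1 • x.2) '' s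
  have hex : ∃ n : ℕ, ∃ s : Finset (V × M),
      Submodule.span (PathAlgebra k V) (gen s) = ⊤ ∧ s.card = n := by
    obtain ⟨t, ht⟩ := Module.Finite.fg_top (R := PathAlgebra k V) (M := M)
    refine ⟨_, Finset.univ ×ˢ t, ?_, rfl⟩
    rw [eq_top_iff, ← ht, Submodule.span_le]
    intro m hm
    have h1 : m = ∑ v : V, idem k v • m := by rw [← Finset.sum_smul, sum_idem (k := k), one_smul]
    rw [h1]
    exact Submodule.sum_mem _ fun v _ => Submodule.subset_span ⟨(v, m), by simpa using hm, rfl⟩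
  obtain ⟨s, hs, hcard⟩ := Nat.find_spec hex
  have hmin : ∀ t : Finset (V × M), Submodule.span (PathAlgebra k V) (gen t) = ⊤ →
      s.card ≤ t.card := fun t ht => hcard ▸ Nat.find_min' hex ⟨t, ht, rfl⟩
  let S : V → Finset M := fun v => (s.filter fun x => x.1 = v).image Prod.snd
  have hS : ∀ v m, m ∈ S v ↔ (v, m) ∈ s := fun v m => by simp [S]
  let m : ∀ v, Fin (S v).card → M := fun v i => ((S v).equivFin.symm i : M)
  have hm : ∀ v i, (v, m v i) ∈ s := fun v i => (hS _ _).1 ((S v).equivFin.symm i).2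
  have hm_inj : ∀ v i j, m v i = m v j → i = j := fun v i j h =>
    (S v).equivFin.symm.injective (Subtype.ext h)
  refine ⟨fun v => (S v).card, generatorMap m, ?_, fun N hN => ?_⟩
  · rw [← LinearMap.range_eq_top, eq_top_iff, ← hs, Submodule.span_le]
    rintro _ ⟨⟨v, y⟩, hy, rfl⟩
    refine ⟨generator v ((S v).equivFin ⟨y, (hS v y).2 hy⟩), ?_⟩
    rw [generatorMap_generator]
    simp [m]
  · refine eq_top_of_sup_eq_top hV (fun x hx w i₀ => ?_) hN
    by_contra hc
    -- A relation with an invertible coefficient makes one of the generators redundant.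
    have hred : idem k w • m w i₀ ∈
        Submodule.span (PathAlgebra k V) (gen (s.erase (w, m w i₀))) := by
      have h1 : ∑ v, ∑ i, (idem k w * (x v i : PathAlgebra k V)) • m v i = 0 := by
        have := congr_arg (idem k w • ·) ((generatorMap_apply m x).symm.trans hx)
        simpa only [Finset.smul_sum, smul_smul, smul_zero] using this
      have hother : ∀ v i, (v, m v i) ≠ (w, m w i₀) →
          (idem k w * (x v i : PathAlgebra k V)) • m v i ∈
            Submodule.span (PathAlgebra k V) (gen (s.erase (w, m w i₀))) := fun v i hne => by
        rw [← mem_vertexProjective.1 (x v i).2, ← mul_assoc, mul_smul]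
        exact Submodule.smul_mem _ _ (Submodule.subset_span
          ⟨(v, m v i), Finset.mem_coe.2 (Finset.mem_erase.2 ⟨hne, hm v i⟩), rfl⟩)
      rw [← Finset.add_sum_erase _ _ (Finset.mem_univ w),
        ← Finset.add_sum_erase _ _ (Finset.mem_univ i₀), add_assoc,
        idem_mul_eq_coeff_smul hV (x w i₀).2] at h1
      have h2 : (coeff (trivialPath w) (x w i₀ : PathAlgebra k V) • idem k w) • m w i₀ ∈
          Submodule.span (PathAlgebra k V) (gen (s.erase (w, m w i₀))) := by
        rw [eq_neg_of_add_eq_zero_left h1]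
        refine Submodule.neg_mem _ (Submodule.add_mem _ ?_ ?_)
        · refine Submodule.sum_mem _ fun i hi => hother _ _ fun h => ?_
          exact (Finset.ne_of_mem_erase hi) (hm_inj _ _ _ (congr_arg Prod.snd h))
        · refine Submodule.sum_mem _ fun v hv => Submodule.sum_mem _ fun i _ =>
            hother _ _ fun h => ?_
          exact (Finset.ne_of_mem_erase hv) (congr_arg Prod.fst h)
      have h3 := Submodule.smul_mem _ (algebraMap k (PathAlgebra k V)
        (coeff (trivialPath w) (x w i₀ : PathAlgebra k V))⁻¹) h2
      rwa [smul_smul, ← Algebra.smul_def, smul_smul, inv_mul_cancel₀ hc, one_smul] at h3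
    have hspan : Submodule.span (PathAlgebra k V) (gen (s.erase (w, m w i₀))) = ⊤ := by
      rw [eq_top_iff, ← hs, Submodule.span_le]
      rintro _ ⟨y, hy, rfl⟩
      by_cases h : y = (w, m w i₀)
      · rw [h]; exact hred
      · exact Submodule.subset_span ⟨y, Finset.mem_coe.2 (Finset.mem_erase.2 ⟨h, hy⟩), rfl⟩
    have := hmin _ hspan
    rw [Finset.card_erase_of_mem (hm w i₀)] at this
    have : 0 < s.card := Finset.card_pos.2 ⟨_, hm w i₀⟩
    omega

end ProjectiveCover

/-! ### Minimal projective presentations -/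

section Finiteness

variable (k : Type u) [Field k] {V : Type u} [Quiver.{u} V] [Fintype V]

theorem module_finite [∀ v w : V, Finite (v ⟶ w)] (hV : QuiverAcyclic V) :
    Module.Finite k (PathAlgebra k V) :=
  have := hV.finite_quiverPath
  Module.Finite.of_basis (pathBasis k)

variable {k}

/-- The kernel of a projective cover is projective, so its own projective cover is an
isomorphism. -/
theorem exists_isGVector [∀ v w : V, Finite (v ⟶ w)] (hV : QuiverAcyclic V)
    (M : ModuleCat.{u} (PathAlgebra k V)) [Module.Finite (PathAlgebra k V) M] :
    ∃ g, IsGVector k M g := by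
  obtain ⟨a, π, hπ, hsup⟩ := exists_projectiveCover (k := k) (M := M) hV
  have := module_finite k hV
  have : IsNoetherianRing (PathAlgebra k V) := IsNoetherianRing.of_finite k _
  have : ∀ v : V, Module.Finite (PathAlgebra k V) (vertexProjective k v) := fun v => inferInstance
  have : Module.Finite (PathAlgebra k V) (projectiveSum k a) := inferInstance
  have : Module.Finite (PathAlgebra k V) (LinearMap.ker π) := inferInstance
  have := hasProjectiveSubmodules_projectiveSum (k := k) hV a (LinearMap.ker π)
  obtain ⟨b, ρ, hρ, hsup'⟩ := exists_projectiveCover (k := k) (M := LinearMap.ker π) hV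
  obtain ⟨s, hs⟩ := Module.projective_lifting_property ρ LinearMap.id hρ
  have hs' : ∀ x, ρ (s x) = x := fun x => LinearMap.congr_fun hs x
  have htop : LinearMap.range s = ⊤ := by
    refine hsup' _ (Submodule.eq_top_iff'.2 fun x => Submodule.mem_sup.2
      ⟨s (ρ x), ⟨_, rfl⟩, x - s (ρ x), ?_, by abel⟩)
    rw [LinearMap.mem_ker, map_sub, hs', sub_self]
  have hρi : Function.Injective ρ := by
    have hl : Function.LeftInverse ρ s := hs'
    exact (hl.rightInverse_of_surjective (LinearMap.range_eq_top.1 htop)).injective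
  refine ⟨fun v => (a v : ℤ) - (b v : ℤ), a, b, (LinearMap.ker π).subtype ∘ₗ ρ, π,
    (Submodule.injective_subtype _).comp hρi, fun x => ⟨fun hx => ?_, ?_⟩, hπ, hsup, fun v => rfl⟩
  · obtain ⟨y, hy⟩ := hρ ⟨x, hx⟩
    exact ⟨y, congr_arg Subtype.val hy⟩
  · rintro ⟨y, rfl⟩
    exact (ρ y).2

end Finiteness

end PathAlgebra

namespace PathAlgebra

variable {k : Type u} [Field k] {V : Type u} [Quiver.{u} V] [Fintype V]

/-! ### The vector spaces at the vertices -/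

section VertexSpace

variable (k) (M : Type u) [AddCommGroup M] [Module k M] [Module (PathAlgebra k V) M]
  [IsScalarTower k (PathAlgebra k V) M]

/-- The vector space `e_v M` of a module `M` over the path algebra that carries a compatible
structure of `k`-vector space. -/
def vspace (v : V) : Submodule k M :=
  LinearMap.range (Algebra.lsmul k k M (idem k v))

/-- The dimension of `e_v M`. -/
def vdim (v : V) : ℕ :=
  Module.finrank k (vspace k M v)

variable {k M}

theorem mem_vspace {v : V} {x : M} : x ∈ vspace k M v ↔ idem k v • x = x := by
  constructor
  · rintro ⟨y, rfl⟩
    rw [Algebra.lsmul_coe, smul_smul, idem_mul_idem]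
  · exact fun h => ⟨x, h⟩

theorem vdim_eq_zero_iff [Module.Finite k M] {v : V} :
    vdim k M v = 0 ↔ ∀ x : M, idem k v • x = 0 := by
  rw [vdim, Submodule.finrank_eq_zero, Submodule.eq_bot_iff]
  exact ⟨fun h x => h _ ⟨x, rfl⟩, by rintro h _ ⟨x, rfl⟩; exact h x⟩

/-- Homomorphisms from `P_v` to `M` are determined by the image of `e_v` in `e_v M`. -/
def homVertexEquiv (v : V) :
    (vertexProjective k v →ₗ[PathAlgebra k V] M) ≃ₗ[k] vspace k M v where
  toFun f := ⟨f ⟨idem k v, idem_mem_vertexProjective v⟩, by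
    rw [mem_vspace, ← map_smul]
    exact congr_arg f (Subtype.ext (idem_mul_idem v))⟩
  map_add' f g := rfl
  map_smul' c f := rfl
  invFun x := LinearMap.toSpanSingleton (PathAlgebra k V) M x ∘ₗ (vertexProjective k v).subtype
  left_inv f := by
    refine LinearMap.ext fun x => ?_
    rw [LinearMap.comp_apply, LinearMap.toSpanSingleton_apply, Submodule.subtype_apply, ← map_smul]
    exact congr_arg f (Subtype.ext (mem_vertexProjective.1 x.2))
  right_inv x := Subtype.ext (mem_vspace.1 x.2)

variable {N : Type u} [AddCommGroup N] [Module k N] [Module (PathAlgebra k V) N]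
  [IsScalarTower k (PathAlgebra k V) N]

theorem finite_hom [Module.Finite k M] [Module.Finite k N] :
    Module.Finite k (M →ₗ[PathAlgebra k V] N) :=
  Module.Finite.of_injective (LinearMap.restrictScalarsₗ k (PathAlgebra k V) M N k)
    (LinearMap.restrictScalars_injective k)

theorem finite_submodule [Module.Finite k M] (U : Submodule (PathAlgebra k V) M) :
    Module.Finite k U :=
  Module.Finite.of_injective (U.subtype.restrictScalars k) U.injective_subtype

theorem finite_quotient [Module.Finite k M] (U : Submodule (PathAlgebra k V) M) :
    Module.Finite k (M ⧸ U) :=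
  Module.Finite.of_surjective (U.mkQ.restrictScalars k) U.mkQ_surjective

theorem vdim_congr (e : M ≃ₗ[PathAlgebra k V] N) (v : V) : vdim k M v = vdim k N v := by
  let e' : M ≃ₗ[k] N := e.restrictScalars k
  have : (vspace k M v).map (e' : M →ₗ[k] N) = vspace k N v := by
    ext y
    constructor
    · rintro ⟨x, hx, rfl⟩
      rw [mem_vspace]
      exact (map_smul e _ _).symm.trans (congr_arg e (mem_vspace.1 hx))
    · intro hy
      refine ⟨e.symm y, ?_, e.apply_symm_apply y⟩
      exact mem_vspace.2 ((map_smul e.symm _ _).symm.trans (congr_arg e.symm (mem_vspace.1 hy)))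
  rw [vdim, vdim, ← this]
  exact (LinearEquiv.finrank_map_eq e' (vspace k M v)).symm

end VertexSpace

/-! ### Pairing a `g`-vector with a dimension vector -/

section Presentation

variable (k) in
/-- The module `M` has a projective presentation `0 → ⊕ b_v P_v → ⊕ a_v P_v → M → 0`, not
necessarily minimal, with `g = a - b`. -/
def HasPresentation (M : Type u) [AddCommGroup M] [Module (PathAlgebra k V) M] (g : V → ℤ) :
    Prop :=
  ∃ (a b : V → ℕ) (f : projectiveSum k b →ₗ[PathAlgebra k V] projectiveSum k a)
    (π : projectiveSum k a →ₗ[PathAlgebra k V] M),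
    Function.Injective f ∧ Function.Exact f π ∧ Function.Surjective π ∧
      ∀ v, g v = (a v : ℤ) - (b v : ℤ)

variable {M N : Type u} [AddCommGroup M] [Module (PathAlgebra k V) M] [AddCommGroup N]
  [Module (PathAlgebra k V) N]

theorem HasPresentation.extVanish_of_surjective {g : V → ℤ} (h : HasPresentation k M g)
    {L : Type u} [AddCommGroup L] [Module (PathAlgebra k V) L]
    (H : ExtVanish (PathAlgebra k V) M L) (q : L →ₗ[PathAlgebra k V] N)
    (hq : Function.Surjective q) : ExtVanish (PathAlgebra k V) M N := by
  obtain ⟨a, b, f, π, hf, hfπ, hπ, -⟩ := h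
  exact H.of_surjective f π hf hfπ hπ q hq

variable [Module k N] [IsScalarTower k (PathAlgebra k V) N]

theorem finrank_hom_projectiveSum [Module.Finite k N] (a : V → ℕ) :
    Module.finrank k (projectiveSum k a →ₗ[PathAlgebra k V] N) = ∑ v, a v * vdim k N v := by
  classical
  have hf : ∀ v, Module.Finite k (vertexProjective k v →ₗ[PathAlgebra k V] N) := fun v =>
    Module.Finite.equiv (homVertexEquiv v).symm
  let e1 : ∀ v, (Fin (a v) → (vertexProjective k v →ₗ[PathAlgebra k V] N)) ≃ₗ[k]
      ((Fin (a v) → vertexProjective k v) →ₗ[PathAlgebra k V] N) := fun v =>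
    LinearMap.lsum (PathAlgebra k V) (fun _ : Fin (a v) => vertexProjective k v) k
  let e2 : (∀ v, (Fin (a v) → vertexProjective k v) →ₗ[PathAlgebra k V] N) ≃ₗ[k]
      (projectiveSum k a →ₗ[PathAlgebra k V] N) :=
    LinearMap.lsum (PathAlgebra k V) (fun v => Fin (a v) → vertexProjective k v) k
  rw [← e2.finrank_eq, ← (LinearEquiv.piCongrRight e1).finrank_eq, Module.finrank_pi_fintype]
  refine Finset.sum_congr rfl fun v _ => ?_
  rw [Module.finrank_pi_fintype, Finset.sum_const, Finset.card_univ, Fintype.card_fin, smul_eq_mul,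
    (homVertexEquiv v).finrank_eq]
  rfl

theorem finite_hom_projectiveSum [Module.Finite k N] (a : V → ℕ) :
    Module.Finite k (projectiveSum k a →ₗ[PathAlgebra k V] N) := by
  classical
  have hf : ∀ v, Module.Finite k (vertexProjective k v →ₗ[PathAlgebra k V] N) := fun v =>
    Module.Finite.equiv (homVertexEquiv v).symm
  have e1 : ∀ v, Module.Finite k ((Fin (a v) → vertexProjective k v) →ₗ[PathAlgebra k V] N) :=
    fun v => Module.Finite.equiv
      (LinearMap.lsum (PathAlgebra k V) (fun _ : Fin (a v) => vertexProjective k v) k)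
  exact Module.Finite.equiv
    (LinearMap.lsum (PathAlgebra k V) (fun v => Fin (a v) → vertexProjective k v) k)

variable (k N) in
/-- Precomposition, as a `k`-linear map. -/
def precomp {P Q : Type u} [AddCommGroup P] [Module (PathAlgebra k V) P] [AddCommGroup Q]
    [Module (PathAlgebra k V) Q] (f : P →ₗ[PathAlgebra k V] Q) :
    (Q →ₗ[PathAlgebra k V] N) →ₗ[k] (P →ₗ[PathAlgebra k V] N) where
  toFun h := h ∘ₗ f
  map_add' _ _ := rfl
  map_smul' _ _ := rfl

/-- The difference between `dim Hom(M, N)` and the pairing of the `g`-vector of `M` with the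
dimension vector of `N` is the dimension of the cokernel `Ext¹(M, N)` of
`Hom(P, N) → Hom(P', N)`, for a presentation `0 → P' → P → M → 0`. -/
theorem HasPresentation.exists_finrank_hom_eq [Module.Finite k N] {g : V → ℤ}
    (h : HasPresentation k M g) :
    ∃ c : ℕ, (Module.finrank k (M →ₗ[PathAlgebra k V] N) : ℤ) = ∑ v, g v * vdim k N v + c ∧
      (c = 0 ↔ ExtVanish (PathAlgebra k V) M N) := by
  obtain ⟨a, b, f, π, hf, hfπ, hπ, hg⟩ := h
  have := finite_hom_projectiveSum (k := k) (N := N) a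
  have := finite_hom_projectiveSum (k := k) (N := N) b
  let F := precomp k N f
  let G := precomp k N π
  have hG : Function.Injective G := fun x y hxy => by
    refine LinearMap.ext fun m => ?_
    obtain ⟨p, rfl⟩ := hπ m
    exact LinearMap.congr_fun hxy p
  have hker : LinearMap.ker F = LinearMap.range G := by
    ext x
    constructor
    · intro hx
      have hx' : ∀ p, x (f p) = 0 := fun p => LinearMap.congr_fun hx p
      have hle : LinearMap.ker π ≤ LinearMap.ker x := fun p hp => by
        obtain ⟨q, rfl⟩ := (hfπ p).1 hp
        exact hx' q
      refine ⟨(LinearMap.ker π).liftQ x hle ∘ₗ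
        (π.quotKerEquivOfSurjective hπ).symm.toLinearMap, LinearMap.ext fun p => ?_⟩
      have hs : (π.quotKerEquivOfSurjective hπ).symm (π p) = Submodule.Quotient.mk p := by
        rw [LinearEquiv.symm_apply_eq]; rfl
      change (LinearMap.ker π).liftQ x hle ((π.quotKerEquivOfSurjective hπ).symm (π p)) = x p
      rw [hs]
      rfl
    · rintro ⟨y, rfl⟩
      refine LinearMap.ext fun p => ?_
      change y (π (f p)) = 0
      rw [(hfπ (f p)).2 ⟨p, rfl⟩, map_zero]
  have h1 := LinearMap.finrank_range_add_finrank_ker F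
  rw [hker, LinearMap.finrank_range_of_inj hG, finrank_hom_projectiveSum] at h1
  have h2 := Submodule.finrank_le (LinearMap.range F)
  have h3 := finrank_hom_projectiveSum (k := k) (N := N) b
  have h4 : ∑ v, g v * (vdim k N v : ℤ) =
      ((∑ v, a v * vdim k N v : ℕ) : ℤ) - ((∑ v, b v * vdim k N v : ℕ) : ℤ) := by
    push_cast
    rw [← Finset.sum_sub_distrib]
    exact Finset.sum_congr rfl fun v _ => by rw [hg]; ring
  obtain ⟨c, hc⟩ := Nat.exists_eq_add_of_le h2
  refine ⟨c, ?_, ?_⟩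
  · rw [h4]
    omega
  · have h5 : c = 0 ↔ LinearMap.range F = ⊤ := by
      constructor
      · intro h
        exact Submodule.eq_top_of_finrank_eq (by omega)
      · intro h
        rw [h, finrank_top] at hc
        omega
    rw [h5, LinearMap.range_eq_top]
    constructor
    · intro h
      exact ExtVanish.of_presentation f π hfπ hπ h
    · intro h x
      exact h.exists_extension f π hf hfπ hπ x

/-- The value of a `g`-vector at a dimension vector is `dim Hom - dim Ext¹`. -/
theorem HasPresentation.pairing_le [Module.Finite k N] {g : V → ℤ} (h : HasPresentation k M g) :
    ∑ v, g v * (vdim k N v : ℤ) ≤ Module.finrank k (M →ₗ[PathAlgebra k V] N) := by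
  obtain ⟨c, hc, -⟩ := h.exists_finrank_hom_eq (N := N)
  omega

theorem HasPresentation.pairing_eq_iff [Module.Finite k N] {g : V → ℤ}
    (h : HasPresentation k M g) :
    ∑ v, g v * (vdim k N v : ℤ) = Module.finrank k (M →ₗ[PathAlgebra k V] N) ↔
      ExtVanish (PathAlgebra k V) M N := by
  obtain ⟨c, hc, hc'⟩ := h.exists_finrank_hom_eq (N := N)
  rw [← hc']
  omega

end Presentation

/-! ### The Cartan matrix -/

section Cartan

variable {M : Type u} [AddCommGroup M] [Module k M] [Module (PathAlgebra k V) M]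
  [IsScalarTower k (PathAlgebra k V) M]

variable (k) in
/-- Homomorphisms into a product are families of homomorphisms. -/
def homPiEquiv (X : Type u) [AddCommGroup X] [Module (PathAlgebra k V) X] {ι : Type*}
    (W : ι → Type u) [∀ i, AddCommGroup (W i)] [∀ i, Module k (W i)]
    [∀ i, Module (PathAlgebra k V) (W i)] [∀ i, IsScalarTower k (PathAlgebra k V) (W i)] :
    (X →ₗ[PathAlgebra k V] ∀ i, W i) ≃ₗ[k] ∀ i, X →ₗ[PathAlgebra k V] W i where
  toFun f i := LinearMap.proj i ∘ₗ f
  map_add' _ _ := rfl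
  map_smul' _ _ := rfl
  invFun f := LinearMap.pi f
  left_inv _ := rfl
  right_inv _ := rfl

theorem vdim_eq_finrank_hom (v : V) :
    vdim k M v = Module.finrank k (vertexProjective k v →ₗ[PathAlgebra k V] M) :=
  (homVertexEquiv v).finrank_eq.symm

variable [Module.Finite k (PathAlgebra k V)]

instance finite_vertexProjective (v : V) : Module.Finite k (vertexProjective k v) :=
  finite_submodule _

theorem finrank_hom_vertexProjective_projectiveSum (v : V) (a : V → ℕ) :
    Module.finrank k (vertexProjective k v →ₗ[PathAlgebra k V] projectiveSum k a) =
      ∑ w, a w * vdim k (vertexProjective k w) v := by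
  have hf : ∀ w : V, Module.Finite k (vertexProjective k v →ₗ[PathAlgebra k V]
    vertexProjective k w) := fun w => finite_hom
  have hf' : ∀ w : V, Module.Finite k (vertexProjective k v →ₗ[PathAlgebra k V]
    (Fin (a w) → vertexProjective k w)) := fun w => finite_hom
  rw [(homPiEquiv k _ _).finrank_eq, Module.finrank_pi_fintype]
  refine Finset.sum_congr rfl fun w _ => ?_
  rw [(homPiEquiv k _ _).finrank_eq, Module.finrank_pi_fintype, Finset.sum_const,
    Finset.card_univ, Fintype.card_fin, smul_eq_mul, vdim_eq_finrank_hom]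

/-- The dimension vector is the image of the `g`-vector under the Cartan matrix. -/
theorem HasPresentation.vdim_eq {g : V → ℤ} (h : HasPresentation k M g) (v : V) :
    (vdim k M v : ℤ) = ∑ w, g w * vdim k (vertexProjective k w) v := by
  obtain ⟨a, b, f, π, hf, hfπ, hπ, hg⟩ := h
  have := finite_hom (k := k) (V := V) (M := vertexProjective k v) (N := projectiveSum k a)
  let F : (vertexProjective k v →ₗ[PathAlgebra k V] projectiveSum k b) →ₗ[k]
      (vertexProjective k v →ₗ[PathAlgebra k V] projectiveSum k a) :=
    { toFun := fun x => f ∘ₗ x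
      map_add' := fun x y => LinearMap.comp_add _ _ _
      map_smul' := fun c x => LinearMap.ext fun p =>
        (f.restrictScalars k).map_smul c (x p) }
  have : LinearMap.CompatibleSMul (projectiveSum k a) M k (PathAlgebra k V) := inferInstance
  let G : (vertexProjective k v →ₗ[PathAlgebra k V] projectiveSum k a) →ₗ[k]
      (vertexProjective k v →ₗ[PathAlgebra k V] M) :=
    { toFun := fun x => π ∘ₗ x
      map_add' := fun x y => LinearMap.comp_add _ _ _
      map_smul' := fun c x => LinearMap.ext fun p =>
        (π.restrictScalars k).map_smul c (x p) }
  have hF : Function.Injective F := fun x y hxy => LinearMap.ext fun p =>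
    hf (LinearMap.congr_fun hxy p)
  have hG : LinearMap.range G = ⊤ := LinearMap.range_eq_top.2 fun x =>
    Module.projective_lifting_property π x hπ
  have hker : LinearMap.ker G = LinearMap.range F := by
    ext x
    constructor
    · intro hx
      have hx' : ∀ p, x p ∈ LinearMap.range f := fun p =>
        (hfπ _).1 (LinearMap.congr_fun (show π ∘ₗ x = 0 from hx) p)
      refine ⟨(LinearEquiv.ofInjective f hf).symm.toLinearMap ∘ₗ x.codRestrict _ hx',
        LinearMap.ext fun p => ?_⟩
      exact congr_arg Subtype.val
        ((LinearEquiv.ofInjective f hf).apply_symm_apply (x.codRestrict _ hx' p))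
    · rintro ⟨y, rfl⟩
      exact LinearMap.ext fun p => (hfπ (f (y p))).2 ⟨_, rfl⟩
  have h1 := LinearMap.finrank_range_add_finrank_ker G
  rw [hker, LinearMap.finrank_range_of_inj hF, hG, finrank_top,
    finrank_hom_vertexProjective_projectiveSum, finrank_hom_vertexProjective_projectiveSum,
    ← vdim_eq_finrank_hom] at h1
  have h4 : ∑ w, g w * (vdim k (vertexProjective k w) v : ℤ) =
      ((∑ w, a w * vdim k (vertexProjective k w) v : ℕ) : ℤ) -
        ((∑ w, b w * vdim k (vertexProjective k w) v : ℕ) : ℤ) := by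
    push_cast
    rw [← Finset.sum_sub_distrib]
    exact Finset.sum_congr rfl fun v _ => by rw [hg]; ring
  rw [h4]
  omega

theorem vdim_vertexProjective_self_ne_zero (v : V) : vdim k (vertexProjective k v) v ≠ 0 := by
  classical
  rw [Ne, vdim_eq_zero_iff]
  intro h
  have h1 := congr_arg Subtype.val (h ⟨idem k v, idem_mem_vertexProjective v⟩)
  have h2 : idem k v * idem k v = 0 := h1
  have h3 := congr_arg (coeff (trivialPath v)) h2
  rw [idem_mul_idem, idem, coeff_ofPath] at h3
  simp at h3

theorem vdim_vertexProjective_eq_zero {v w : V} (hvw : v ≠ w) (h : ¬ ProperlyReachable v w) :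
    vdim k (vertexProjective k w) v = 0 := by
  classical
  rw [vdim_eq_zero_iff]
  intro x
  refine Subtype.ext (ext_coeff fun p => ?_)
  have h1 : ((idem k v • x : vertexProjective k w) : PathAlgebra k V) = idem k v * x := rfl
  rw [h1, coeff_idem_mul, Submodule.coe_zero, map_zero]
  split_ifs with hp
  · by_contra hc
    have hs := source_eq_of_coeff_ne_zero x.2 hc
    obtain ⟨s, t, p⟩ := p
    subst hs hp
    exact h ⟨p, fun h => hvw (p.eq_of_length_zero h).symm⟩
  · rfl

/-- The Cartan matrix of an acyclic quiver is triangular with nonzero diagonal entries, hence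
injective. -/
theorem eq_zero_of_cartan (hV : QuiverAcyclic V) {c : V → ℝ}
    (hc : ∀ v : V, ∑ w : V, c w * (vdim k (vertexProjective k w) v : ℝ) = 0) : c = 0 := by
  classical
  funext w
  induction w using hV.wellFounded_flip.induction with
  | _ w ih =>
    have h := hc w
    rw [Finset.sum_eq_single w] at h
    · exact (mul_eq_zero.1 h).resolve_right
        (Nat.cast_ne_zero.2 (vdim_vertexProjective_self_ne_zero w))
    · intro u _ hu
      by_cases huw : ProperlyReachable w u
      · rw [ih u huw, Pi.zero_apply, zero_mul]
      · rw [vdim_vertexProjective_eq_zero hu.symm huw, Nat.cast_zero, mul_zero]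
    · simp

end Cartan

end PathAlgebra

namespace PathAlgebra

variable {k : Type u} [Field k] {V : Type u} [Quiver.{u} V] [Fintype V]

/-! ### Approximations and traces -/

section Approximation

variable {ι : Type} [Fintype ι] (T : ι → Type u) [∀ i, AddCommGroup (T i)] [∀ i, Module k (T i)]
  [∀ i, Module (PathAlgebra k V) (T i)] [∀ i, IsScalarTower k (PathAlgebra k V) (T i)]
  [∀ i, Module.Finite k (T i)]
  (N : Type u) [AddCommGroup N] [Module k N] [Module (PathAlgebra k V) N]
  [IsScalarTower k (PathAlgebra k V) N] [Module.Finite k N]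

variable (k V)

/-- The sum of copies of the modules `T i`, one for each element of a basis of `Hom(T i, N)`. -/
abbrev approximation : Type u :=
  ∀ r : (Σ i, Fin (Module.finrank k (T i →ₗ[PathAlgebra k V] N))), T r.1

/-- The right `add T`-approximation of `N`. Its image is the trace of the family `T` in `N`. -/
def approximationMap : approximation k V T N →ₗ[PathAlgebra k V] N :=
  ∑ r : (Σ i, Fin (Module.finrank k (T i →ₗ[PathAlgebra k V] N))),
    letI : Module.Finite k (T r.1 →ₗ[PathAlgebra k V] N) := finite_hom
    (Module.finBasis k (T r.1 →ₗ[PathAlgebra k V] N) r.2) ∘ₗ LinearMap.proj r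

theorem exists_approximationMap_comp_eq (i : ι) (φ : T i →ₗ[PathAlgebra k V] N) :
    ∃ ψ : T i →ₗ[PathAlgebra k V] approximation k V T N, approximationMap k V T N ∘ₗ ψ = φ := by
  classical
  let : Module.Finite k (T i →ₗ[PathAlgebra k V] N) := finite_hom
  let b := Module.finBasis k (T i →ₗ[PathAlgebra k V] N)
  let W : (Σ i, Fin (Module.finrank k (T i →ₗ[PathAlgebra k V] N))) → Type u := fun r => T r.1
  have h1 : ∀ j, approximationMap k V T N ∘ₗ
      LinearMap.single (PathAlgebra k V) W ⟨i, j⟩ = b j := fun j => by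
    refine LinearMap.ext fun x => ?_
    rw [LinearMap.comp_apply, approximationMap, LinearMap.sum_apply,
      Finset.sum_eq_single ⟨i, j⟩]
    · rw [LinearMap.comp_apply, LinearMap.proj_apply, LinearMap.single_apply, Pi.single_eq_same]
    · intro r _ hr
      rw [LinearMap.comp_apply, LinearMap.proj_apply, LinearMap.single_apply,
        Pi.single_eq_of_ne hr, map_zero]
    · simp
  refine ⟨∑ j, LinearMap.single (PathAlgebra k V) W ⟨i, j⟩ ∘ₗ
    (b.repr φ j • (LinearMap.id : T i →ₗ[PathAlgebra k V] T i)), ?_⟩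
  conv_rhs => rw [← b.sum_repr φ]
  refine LinearMap.ext fun x => ?_
  rw [LinearMap.comp_apply, LinearMap.sum_apply, LinearMap.sum_apply, map_sum]
  refine Finset.sum_congr rfl fun j _ => ?_
  have h2 := LinearMap.congr_fun (h1 j) (b.repr φ j • x)
  rw [LinearMap.comp_apply] at h2
  refine h2.trans ?_
  exact ((b j).restrictScalars k).map_smul _ _

/-- Homomorphisms from the members of the family to the quotient of `N` by the trace vanish if
`Ext¹` from the family to the trace does. -/
theorem hom_quotient_range_eq_zero
    {i : ι} (h : ExtVanish (PathAlgebra k V) (T i) (LinearMap.range (approximationMap k V T N)))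
    (φ : T i →ₗ[PathAlgebra k V] N ⧸ LinearMap.range (approximationMap k V T N)) : φ = 0 := by
  obtain ⟨ψ, rfl⟩ := h.exists_lift (LinearMap.range (approximationMap k V T N)).subtype
    (LinearMap.range (approximationMap k V T N)).mkQ (Submodule.injective_subtype _)
    (LinearMap.exact_subtype_mkQ _) (Submodule.mkQ_surjective _) φ
  obtain ⟨χ, rfl⟩ := exists_approximationMap_comp_eq k V T N i ψ
  refine LinearMap.ext fun x => ?_
  rw [LinearMap.comp_apply, Submodule.mkQ_apply, LinearMap.zero_apply,
    Submodule.Quotient.mk_eq_zero]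
  exact ⟨χ x, rfl⟩

end Approximation

/-! ### Families of modules determined by a vector -/

section Weight

/-- The value of `x : ℝ^V` at the dimension vector of `N`. -/
def pairing (k : Type u) [Field k] {V : Type u} [Quiver.{u} V] [Fintype V] (x : V → ℝ)
    (N : Type u) [AddCommGroup N] [Module k N] [Module (PathAlgebra k V) N]
    [IsScalarTower k (PathAlgebra k V) N] : ℝ :=
  ∑ v, x v * vdim k N v

variable {ι : Type} [Fintype ι] (T : ι → Type u) [∀ i, AddCommGroup (T i)] [∀ i, Module k (T i)]
  [∀ i, Module (PathAlgebra k V) (T i)] [∀ i, IsScalarTower k (PathAlgebra k V) (T i)]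

variable (k) in
/-- The vector `x` is a positive combination of the `g`-vectors of a family of modules without
mutual extensions and a nonnegative combination of the vectors `-e_v`, where `v` is not in the
support of the family if `-e_v` has a nonzero coefficient. -/
structure IsRigidCombination (g : ι → V → ℤ) (c : ι → ℝ) (d x : V → ℝ) : Prop where
  presentation : ∀ i, HasPresentation k (T i) (g i)
  ext : ∀ i j, ExtVanish (PathAlgebra k V) (T i) (T j)
  pos : ∀ i, 0 < c i
  nonneg : ∀ v, 0 ≤ d v
  support : ∀ i v, d v ≠ 0 → vdim k (T i) v = 0
  eq : ∀ v, x v = ∑ i, c i * g i v - d v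

variable {T}
variable {N : Type u} [AddCommGroup N] [Module k N] [Module (PathAlgebra k V) N]
  [IsScalarTower k (PathAlgebra k V) N]

namespace IsRigidCombination

variable {g : ι → V → ℤ} {c : ι → ℝ} {d x : V → ℝ}

theorem pairing_eq (h : IsRigidCombination k T g c d x) :
    pairing k x N = ∑ i, c i * ((∑ v, g i v * (vdim k N v : ℤ) : ℤ) : ℝ) -
      ∑ v, d v * (vdim k N v : ℝ) := by
  have h1 : ∀ i, c i * ((∑ v, g i v * (vdim k N v : ℤ) : ℤ) : ℝ) =
      ∑ v, c i * g i v * (vdim k N v : ℝ) := fun i => by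
    push_cast
    rw [Finset.mul_sum]
    exact Finset.sum_congr rfl fun v _ => by ring
  simp only [h1]
  rw [Finset.sum_comm, ← Finset.sum_sub_distrib, pairing]
  refine Finset.sum_congr rfl fun v _ => ?_
  rw [h.eq, sub_mul, Finset.sum_mul]

theorem extVanish_approximation (h : IsRigidCombination k T g c d x) (i : ι) :
    ExtVanish (PathAlgebra k V) (T i) (approximation k V T N) :=
  ExtVanish.pi fun _ => h.ext _ _

theorem idem_smul_approximation (h : IsRigidCombination k T g c d x) {v : V} (hv : d v ≠ 0)
    [∀ i, Module.Finite k (T i)]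
    (y : approximation k V T N) : idem k v • y = 0 :=
  funext fun r => vdim_eq_zero_iff.1 (h.support r.1 v hv) (y r)

variable [Module.Finite k N]

theorem pairing_eq_sum_finrank (h : IsRigidCombination k T g c d x)
    (hN : ∀ i, ExtVanish (PathAlgebra k V) (T i) N) (hd : ∀ v, d v ≠ 0 → vdim k N v = 0) :
    pairing k x N =
      ∑ i, c i * (Module.finrank k (T i →ₗ[PathAlgebra k V] N) : ℝ) := by
  have h2 : ∑ v, d v * (vdim k N v : ℝ) = 0 := Finset.sum_eq_zero fun v _ => by
    by_cases hv : d v = 0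
    · rw [hv, zero_mul]
    · rw [hd v hv, Nat.cast_zero, mul_zero]
  rw [h.pairing_eq, h2, sub_zero]
  refine Finset.sum_congr rfl fun i _ => ?_
  rw [((h.presentation i).pairing_eq_iff).2 (hN i), Int.cast_natCast]

theorem pairing_nonpos (h : IsRigidCombination k T g c d x)
    (hN : ∀ i (φ : T i →ₗ[PathAlgebra k V] N), φ = 0) : pairing k x N ≤ 0 := by
  rw [h.pairing_eq, sub_nonpos]
  refine (Finset.sum_nonpos fun i _ => ?_).trans
    (Finset.sum_nonneg fun v _ => mul_nonneg (h.nonneg v) (Nat.cast_nonneg _))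
  have : Subsingleton (T i →ₗ[PathAlgebra k V] N) :=
    ⟨fun φ ψ => (hN i φ).trans (hN i ψ).symm⟩
  have h1 := (h.presentation i).pairing_le (k := k) (N := N)
  rw [Module.finrank_zero_of_subsingleton] at h1
  exact mul_nonpos_of_nonneg_of_nonpos (h.pos i).le (by exact_mod_cast h1)

theorem extVanish_of_pairing_nonneg (h : IsRigidCombination k T g c d x)
    (hN : ∀ i (φ : T i →ₗ[PathAlgebra k V] N), φ = 0) (h0 : 0 ≤ pairing k x N) (i : ι) :
    ExtVanish (PathAlgebra k V) (T i) N := by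
  have hs : ∀ i, Module.finrank k (T i →ₗ[PathAlgebra k V] N) = 0 := fun i => by
    have : Subsingleton (T i →ₗ[PathAlgebra k V] N) :=
      ⟨fun φ ψ => (hN i φ).trans (hN i ψ).symm⟩
    exact Module.finrank_zero_of_subsingleton
  have hle : ∀ i ∈ Finset.univ, c i * ((∑ v, g i v * (vdim k N v : ℤ) : ℤ) : ℝ) ≤ 0 :=
    fun i _ => by
      have h1 := (h.presentation i).pairing_le (k := k) (N := N)
      rw [hs, Nat.cast_zero] at h1
      exact mul_nonpos_of_nonneg_of_nonpos (h.pos i).le (by exact_mod_cast h1)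
  have hd : 0 ≤ ∑ v, d v * (vdim k N v : ℝ) :=
    Finset.sum_nonneg fun v _ => mul_nonneg (h.nonneg v) (Nat.cast_nonneg _)
  rw [h.pairing_eq] at h0
  have h1 := Finset.sum_nonpos hle
  have h2 := (Finset.sum_eq_zero_iff_of_nonpos hle).1 (by linarith) i (Finset.mem_univ i)
  rw [← (h.presentation i).pairing_eq_iff (k := k), hs, Nat.cast_zero]
  exact_mod_cast (mul_eq_zero.1 h2).resolve_left (h.pos i).ne'

theorem pairing_quotient_nonneg (h : IsRigidCombination k T g c d x)
    (hN : ∀ i, ExtVanish (PathAlgebra k V) (T i) N) (hd : ∀ v, d v ≠ 0 → vdim k N v = 0)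
    (U : Submodule (PathAlgebra k V) N) : 0 ≤ pairing k x (N ⧸ U) := by
  have := finite_quotient (k := k) U
  rw [h.pairing_eq_sum_finrank
    (fun i => (h.presentation i).extVanish_of_surjective (hN i) U.mkQ U.mkQ_surjective)
    fun v hv => vdim_eq_zero_iff.2 fun y => by
      obtain ⟨z, rfl⟩ := U.mkQ_surjective y
      rw [← map_smul, vdim_eq_zero_iff.1 (hd v hv), map_zero]]
  exact Finset.sum_nonneg fun i _ => mul_nonneg (h.pos i).le (Nat.cast_nonneg _)

variable [∀ i, Module.Finite k (T i)]

/-- If the family generates `N`, then `x` is positive on the nonzero quotients of `N`. -/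
theorem pairing_quotient_pos (h : IsRigidCombination k T g c d x)
    (hN : Function.Surjective (approximationMap k V T N)) (U : Submodule (PathAlgebra k V) N)
    (hU : U ≠ ⊤) : 0 < pairing k x (N ⧸ U) := by
  have := finite_quotient (k := k) U
  let q : approximation k V T N →ₗ[PathAlgebra k V] N ⧸ U := U.mkQ ∘ₗ approximationMap k V T N
  have hq : Function.Surjective q := U.mkQ_surjective.comp hN
  rw [h.pairing_eq_sum_finrank
    (fun i => (h.presentation i).extVanish_of_surjective (h.extVanish_approximation i) q hq)
    fun v hv => vdim_eq_zero_iff.2 fun y => by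
      obtain ⟨z, rfl⟩ := hq y
      rw [← map_smul, h.idem_smul_approximation hv, map_zero]]
  refine Finset.sum_pos' (fun i _ => mul_nonneg (h.pos i).le (Nat.cast_nonneg _)) ?_
  by_contra! hcon
  have h0 : ∀ i (φ : T i →ₗ[PathAlgebra k V] N ⧸ U), φ = 0 := fun i φ => by
    have := finite_hom (k := k) (V := V) (M := T i) (N := N ⧸ U)
    have h1 : (Module.finrank k (T i →ₗ[PathAlgebra k V] N ⧸ U) : ℝ) ≤ 0 := by
      by_contra! h2
      exact absurd (hcon i (Finset.mem_univ i)) (not_le.2 (mul_pos (h.pos i) h2))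
    have h2 : Module.finrank k (T i →ₗ[PathAlgebra k V] N ⧸ U) = 0 := by
      exact_mod_cast le_antisymm h1 (Nat.cast_nonneg _)
    have := Module.finrank_zero_iff.1 h2
    exact Subsingleton.elim _ _
  refine hU (Submodule.eq_top_iff'.2 fun y => ?_)
  rw [← Submodule.Quotient.mk_eq_zero]
  obtain ⟨z, hz⟩ := hq (Submodule.Quotient.mk y)
  rw [← hz]
  classical
  have hz1 : z = ∑ r, Pi.single r (z r) := (Finset.univ_sum_single z).symm
  rw [hz1, map_sum]
  refine Finset.sum_eq_zero fun r _ => ?_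
  exact LinearMap.congr_fun (h0 r.1 (q ∘ₗ LinearMap.single (PathAlgebra k V)
    (fun r : (Σ i, Fin (Module.finrank k (T i →ₗ[PathAlgebra k V] N))) => T r.1) r)) (z r)

/-- If `x` is positive on the nonzero quotients of `N`, then the family generates `N`: otherwise the
quotient of `N` by the trace of the family would be a counterexample. -/
theorem approximationMap_surjective (h : IsRigidCombination k T g c d x)
    (hN : ∀ U : Submodule (PathAlgebra k V) N, U ≠ ⊤ → 0 < pairing k x (N ⧸ U)) :
    Function.Surjective (approximationMap k V T N) := by
  rw [← LinearMap.range_eq_top]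
  by_contra hU
  have := finite_quotient (k := k) (LinearMap.range (approximationMap k V T N))
  have h1 := hN _ hU
  refine absurd h1 (not_lt.2 (h.pairing_nonpos fun i φ => hom_quotient_range_eq_zero k V T N ?_ φ))
  exact (h.presentation i).extVanish_of_surjective (h.extVanish_approximation i)
    (approximationMap k V T N).rangeRestrict (LinearMap.surjective_rangeRestrict _)

/-- If `x` is nonnegative on the quotients of `N`, then `Ext¹` from the family to `N` vanishes:
it vanishes for the trace of the family in `N`, and for the quotient by the trace, on which `x` is
nonpositive. -/
theorem extVanish_of_pairing_quotient_nonneg (h : IsRigidCombination k T g c d x)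
    (hN : ∀ U : Submodule (PathAlgebra k V) N, 0 ≤ pairing k x (N ⧸ U)) (i : ι) :
    ExtVanish (PathAlgebra k V) (T i) N := by
  have := finite_quotient (k := k) (LinearMap.range (approximationMap k V T N))
  have h1 : ∀ i, ExtVanish (PathAlgebra k V) (T i) (LinearMap.range (approximationMap k V T N)) :=
    fun i => (h.presentation i).extVanish_of_surjective (h.extVanish_approximation i)
      (approximationMap k V T N).rangeRestrict (LinearMap.surjective_rangeRestrict _)
  have h2 := h.extVanish_of_pairing_nonneg
    (fun i φ => hom_quotient_range_eq_zero k V T N (h1 i) φ) (hN _)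
  exact ExtVanish.of_exact (LinearMap.range (approximationMap k V T N)).subtype
    (LinearMap.range (approximationMap k V T N)).mkQ (Submodule.injective_subtype _)
    (LinearMap.exact_subtype_mkQ _) (Submodule.mkQ_surjective _) (h1 i) (h2 i)

/-- Two families with the same positive combination `x` have the same members up to isomorphism.
The modules generated by a family are those on whose nonzero quotients `x` is positive, so `T' j` is
a quotient of a sum of copies of the `T i`. The kernel is a module on whose quotients `x` is
nonnegative, so `Ext¹` from `T' j` to it vanishes, and the quotient is a direct summand. -/
theorem exists_linearEquiv (h : IsRigidCombination k T g c d x)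
    {κ : Type} [Fintype κ] {T' : κ → Type u} [∀ i, AddCommGroup (T' i)] [∀ i, Module k (T' i)]
    [∀ i, Module (PathAlgebra k V) (T' i)] [∀ i, IsScalarTower k (PathAlgebra k V) (T' i)]
    [∀ i, Module.Finite k (T' i)] {g' : κ → V → ℤ} {c' : κ → ℝ} {d' : V → ℝ}
    (h' : IsRigidCombination k T' g' c' d' x)
    (hT : ∀ i, IsIndecomposableModule (PathAlgebra k V) (T i)) {j : κ}
    (hT' : IsIndecomposableModule (PathAlgebra k V) (T' j)) :
    ∃ i, Nonempty (T' j ≃ₗ[PathAlgebra k V] T i) := by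
  have hgen' : Function.Surjective (approximationMap k V T' (T' j)) := fun y => by
    obtain ⟨ψ, hψ⟩ := exists_approximationMap_comp_eq k V T' (T' j) j LinearMap.id
    exact ⟨ψ y, LinearMap.congr_fun hψ y⟩
  have hgen : Function.Surjective (approximationMap k V T (T' j)) :=
    h.approximationMap_surjective (h'.pairing_quotient_pos hgen')
  let q := approximationMap k V T (T' j)
  have := finite_submodule (k := k) (LinearMap.ker q)
  have hK : ∀ i, ExtVanish (PathAlgebra k V) (T i) (LinearMap.ker q) := fun i =>
    (h.extVanish_approximation i).of_exact_of_surjective (LinearMap.ker q).subtype q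
      (Submodule.injective_subtype _) (LinearMap.exact_subtype_ker_map q)
      (exists_approximationMap_comp_eq k V T (T' j) i)
  have hKd : ∀ v, d v ≠ 0 → vdim k (LinearMap.ker q) v = 0 := fun v hv =>
    vdim_eq_zero_iff.2 fun y => Subtype.ext (h.idem_smul_approximation hv y.1)
  have hK' : ExtVanish (PathAlgebra k V) (T' j) (LinearMap.ker q) :=
    h'.extVanish_of_pairing_quotient_nonneg (h.pairing_quotient_nonneg hK hKd) j
  obtain ⟨s, hs⟩ := hK'.exists_lift (LinearMap.ker q).subtype q (Submodule.injective_subtype _)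
    (LinearMap.exact_subtype_ker_map q) hgen LinearMap.id
  have : IsArtinian (PathAlgebra k V) (T' j) := isArtinian_of_tower k inferInstance
  have : IsNoetherian (PathAlgebra k V) (T' j) := isNoetherian_of_tower k inferInstance
  obtain ⟨r, hr⟩ := hT'.exists_equiv_of_retract_pi (fun r => hT r.1) q s hs
  exact ⟨r.1, hr⟩

end IsRigidCombination

end Weight

end PathAlgebra

namespace PathAlgebra

variable {k : Type u} [Field k] {V : Type u} [Quiver.{u} V] [Fintype V]

/-! ### Independence of `g`-vectors -/

section Independence

variable {ι : Type} [Fintype ι] {T : ι → Type u} [∀ i, AddCommGroup (T i)] [∀ i, Module k (T i)]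
  [∀ i, Module (PathAlgebra k V) (T i)] [∀ i, IsScalarTower k (PathAlgebra k V) (T i)]
  [∀ i, Module.Finite k (T i)] {g : ι → V → ℤ}

/-- The `g`-vectors of pairwise nonisomorphic indecomposable modules without mutual extensions are
linearly independent, even modulo the coordinate vectors outside the support. A nontrivial relation,
with its positive and negative terms separated, would write one vector as a combination of two
families with no common member. -/
theorem eq_zero_of_sum_gVector_eq (hg : ∀ i, HasPresentation k (T i) (g i))
    (hext : ∀ i j, ExtVanish (PathAlgebra k V) (T i) (T j))
    (hT : ∀ i, IsIndecomposableModule (PathAlgebra k V) (T i))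
    (hne : ∀ i j, Nonempty (T i ≃ₗ[PathAlgebra k V] T j) → i = j) {c : ι → ℝ} {y : V → ℝ}
    (hy : ∀ i v, y v ≠ 0 → vdim k (T i) v = 0) (hc : ∀ v, ∑ i, c i * g i v = y v) : c = 0 := by
  classical
  let x : V → ℝ := fun v => ∑ i : {i // 0 < c i}, c i * g i v - (y v)⁺
  have hp : IsRigidCombination k (fun i : {i // 0 < c i} => T i) (fun i => g i) (fun i => c i)
      (fun v => (y v)⁺) x :=
    { presentation := fun i => hg i
      ext := fun i j => hext i j
      pos := fun i => i.2
      nonneg := fun v => posPart_nonneg _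
      support := fun i v hv => hy i v fun h => hv (by simp [h])
      eq := fun v => rfl }
  have hm : IsRigidCombination k (fun i : {i // c i < 0} => T i) (fun i => g i) (fun i => -c i)
      (fun v => (y v)⁻) x :=
    { presentation := fun i => hg i
      ext := fun i j => hext i j
      pos := fun i => neg_pos.2 i.2
      nonneg := fun v => negPart_nonneg _
      support := fun i v hv => hy i v fun h => hv (by simp [h])
      eq := fun v => by
        have h1 : ∑ i : {i // 0 < c i}, c i * (g i v : ℝ) =
            ∑ i, if 0 < c i then c i * (g i v : ℝ) else 0 := by
          rw [← Finset.sum_filter, ← Finset.sum_subtype_eq_sum_filter]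
          exact Finset.sum_congr (by ext; simp) fun _ _ => rfl
        have h2 : ∑ i : {i // c i < 0}, -c i * (g i v : ℝ) =
            ∑ i, if c i < 0 then -c i * (g i v : ℝ) else 0 := by
          rw [← Finset.sum_filter, ← Finset.sum_subtype_eq_sum_filter]
          exact Finset.sum_congr (by ext; simp) fun _ _ => rfl
        have h3 : ∑ i, (if 0 < c i then c i * (g i v : ℝ) else 0) -
            ∑ i, (if c i < 0 then -c i * (g i v : ℝ) else 0) = y v := by
          rw [← hc v, ← Finset.sum_sub_distrib]
          refine Finset.sum_congr rfl fun i _ => ?_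
          rcases lt_trichotomy (c i) 0 with h | h | h
          · simp [h, h.le]
          · simp [h]
          · simp [h, h.le]
        have h4 := posPart_sub_negPart (y v)
        simp only [x]
        rw [h1, h2]
        linarith }
  funext i
  rcases lt_trichotomy (c i) 0 with h | h | h
  · obtain ⟨⟨j, hj⟩, hij⟩ := hp.exists_linearEquiv hm (fun j => hT j) (j := ⟨i, h⟩) (hT i)
    cases hne i j hij
    exact absurd hj h.not_gt
  · exact h
  · obtain ⟨⟨j, hj⟩, hij⟩ := hm.exists_linearEquiv hp (fun j => hT j) (j := ⟨i, h⟩) (hT i)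
    cases hne i j hij
    exact absurd hj h.not_gt

/-- Two families that have a common positive combination also agree in the coefficients of the
vectors `-e_v`. -/
theorem IsRigidCombination.shift_eq {c : ι → ℝ} {d x : V → ℝ}
    (h : IsRigidCombination k T g c d x)
    {κ : Type} [Fintype κ] {T' : κ → Type u} [∀ i, AddCommGroup (T' i)] [∀ i, Module k (T' i)]
    [∀ i, Module (PathAlgebra k V) (T' i)] [∀ i, IsScalarTower k (PathAlgebra k V) (T' i)]
    [∀ i, Module.Finite k (T' i)] {g' : κ → V → ℤ} {c' : κ → ℝ} {d' : V → ℝ}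
    (h' : IsRigidCombination k T' g' c' d' x)
    (hT : ∀ i, IsIndecomposableModule (PathAlgebra k V) (T i))
    (hT' : ∀ i, IsIndecomposableModule (PathAlgebra k V) (T' i))
    (hne : ∀ i j, Nonempty (T i ≃ₗ[PathAlgebra k V] T j) → i = j)
    (hg : ∀ i j, Nonempty (T' j ≃ₗ[PathAlgebra k V] T i) → g' j = g i) : d = d' := by
  classical
  -- `τ` matches the second family with the first, and the difference of the two expressions is a
  -- relation between `g`-vectors of the first family modulo vectors outside its support.
  choose τ hτ using fun j => h.exists_linearEquiv h' hT (hT' j)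
  have hsum : ∀ v, ∑ j, c' j * (g' j v : ℝ) =
      ∑ i, (∑ j with τ j = i, c' j) * (g i v : ℝ) := fun v => by
    rw [← Finset.sum_fiberwise Finset.univ τ]
    refine Finset.sum_congr rfl fun i _ => ?_
    rw [Finset.sum_mul]
    refine Finset.sum_congr rfl fun j hj => ?_
    rw [← (Finset.mem_filter.1 hj).2, hg _ _ (hτ j)]
  have hrel : ∀ v, ∑ i, (c i - ∑ j with τ j = i, c' j) * (g i v : ℝ) = d v - d' v := fun v => by
    simp only [sub_mul]
    rw [Finset.sum_sub_distrib, ← hsum]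
    linarith [h.eq v, h'.eq v]
  have h0 := eq_zero_of_sum_gVector_eq h.presentation h.ext hT hne (y := fun v => d v - d' v)
    (fun i v hv => by
      by_cases hd : d v = 0
      · obtain ⟨j, ⟨e⟩⟩ := h'.exists_linearEquiv h hT' (hT i)
        rw [vdim_congr e]
        exact h'.support j v fun hd' => hv (by rw [hd, hd', sub_zero])
      · exact h.support i v hd) hrel
  funext v
  have h1 := hrel v
  have h2 : ∀ i, c i - ∑ j with τ j = i, c' j = 0 := fun i => congr_fun h0 i
  simp only [h2, zero_mul, Finset.sum_const_zero] at h1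
  linarith

end Independence

end PathAlgebra

/-! ### Objects of the category of modules -/

section Bridge

open CategoryTheory Limits PathAlgebra

open scoped ModuleCat.Algebra

variable {k : Type u} [Field k] {V : Type u} [Quiver.{u} V] [Fintype V]

theorem dimVector_eq_vdim (M : ModuleCat.{u} (PathAlgebra k V)) (v : V) :
    dimVector k M v = vdim k M v := rfl

theorem isIndecomposableModule_of_indecomposable {M : ModuleCat.{u} (PathAlgebra k V)}
    (h : Indecomposable M) : IsIndecomposableModule (PathAlgebra k V) M := by
  refine ⟨?_, fun p q hpq => ?_⟩
  · by_contra hM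
    rw [not_nontrivial_iff_subsingleton] at hM
    exact h.1 (ModuleCat.isZero_of_subsingleton M)
  · have e : M ≅ ModuleCat.of (PathAlgebra k V) p ⊞ ModuleCat.of (PathAlgebra k V) q :=
      (Submodule.prodEquivOfIsCompl p q hpq).symm.toModuleIso ≪≫
        (ModuleCat.biprodIsoProd (ModuleCat.of (PathAlgebra k V) p)
          (ModuleCat.of (PathAlgebra k V) q)).symm
    rcases h.2 _ _ e with h0 | h0
    · left
      have := ModuleCat.subsingleton_of_isZero h0
      exact (Submodule.subsingleton_iff_eq_bot).1 this
    · right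
      have := ModuleCat.subsingleton_of_isZero h0
      exact (Submodule.subsingleton_iff_eq_bot).1 this

theorem IsGVector.hasPresentation {M : ModuleCat.{u} (PathAlgebra k V)} {g : V → ℤ}
    (h : IsGVector k M g) : HasPresentation k M g := by
  obtain ⟨a, b, f, π, hf, hfπ, hπ, -, hg⟩ := h
  exact ⟨a, b, f, π, hf, hfπ, hπ, hg⟩

theorem hasPresentation_gVector [∀ v w : V, Finite (v ⟶ w)] (hV : QuiverAcyclic V)
    (M : ModuleCat.{u} (PathAlgebra k V)) [Module.Finite (PathAlgebra k V) M] :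
    HasPresentation k M (gVector k M) := by
  have h := exists_isGVector hV M
  rw [gVector, dif_pos h]
  exact h.choose_spec.hasPresentation

theorem IsGVector.of_linearEquiv {M N : ModuleCat.{u} (PathAlgebra k V)} {g : V → ℤ}
    (h : IsGVector k M g) (e : M ≃ₗ[PathAlgebra k V] N) : IsGVector k N g := by
  obtain ⟨a, b, f, π, hf, hfπ, hπ, hsup, hg⟩ := h
  have hker : LinearMap.ker (e.toLinearMap ∘ₗ π) = LinearMap.ker π := LinearEquiv.ker_comp e π
  refine ⟨a, b, f, e.toLinearMap ∘ₗ π, hf, fun x => ?_, e.surjective.comp hπ, ?_, hg⟩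
  · rw [← hfπ x]
    exact e.map_eq_zero_iff
  · rw [hker]
    exact hsup

/-- The `g`-vector is defined by a choice among the vectors that come from a minimal presentation,
and isomorphic modules give the same vectors to choose from. -/
theorem gVector_congr {M N : ModuleCat.{u} (PathAlgebra k V)} (e : M ≃ₗ[PathAlgebra k V] N) :
    gVector k M = gVector k N := by
  have : IsGVector k M = IsGVector k N := funext fun g => propext
    ⟨fun h => h.of_linearEquiv e, fun h => h.of_linearEquiv e.symm⟩
  have h : ∀ P Q : (V → ℤ) → Prop, P = Q →
      (open Classical in if h : ∃ g, P g then h.choose else 0) =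
        (open Classical in if h : ∃ g, Q g then h.choose else 0) := by
    rintro P _ rfl
    rfl
  exact h _ _ this

/-- The extension property for the modules, from the vanishing of `Ext¹` of a module of which they
are direct summands. -/
theorem ExtVanish.of_isRigidModule {M : ModuleCat.{u} (PathAlgebra k V)} (h : IsRigidModule k M)
    {X Y : Type u} [AddCommGroup X] [Module (PathAlgebra k V) X] [AddCommGroup Y]
    [Module (PathAlgebra k V) Y] (i : X →ₗ[PathAlgebra k V] M) (r : M →ₗ[PathAlgebra k V] X)
    (hri : r ∘ₗ i = LinearMap.id) (i' : Y →ₗ[PathAlgebra k V] M) (r' : M →ₗ[PathAlgebra k V] Y)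
    (hri' : r' ∘ₗ i' = LinearMap.id) : ExtVanish (PathAlgebra k V) X Y :=
  ((ExtVanish.of_subsingleton_ext h).of_retract i r hri).of_retract_right i' r' hri'

theorem exists_retract_of_iso_biprod {M T N : ModuleCat.{u} (PathAlgebra k V)} (e : M ≅ T ⊞ N) :
    ∃ (i : T →ₗ[PathAlgebra k V] M) (r : M →ₗ[PathAlgebra k V] T), r ∘ₗ i = LinearMap.id := by
  refine ⟨(biprod.inl ≫ e.inv).hom, (e.hom ≫ biprod.fst).hom, ?_⟩
  rw [← ModuleCat.hom_comp]
  simp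

theorem linearIndependent_fin_of_forall {ι E : Type*} [AddCommGroup E] [Module ℝ E] (f : ι → E)
    (h : ∀ (n : ℕ) (e : Fin n → ι), Function.Injective e → ∀ c : Fin n → ℝ,
      ∑ i, c i • f (e i) = 0 → c = 0) : LinearIndependent ℝ f := by
  rw [linearIndependent_iff']
  intro s c hc i hi
  have h1 := h s.card (fun j => (s.equivFin.symm j : ι))
    (Subtype.val_injective.comp s.equivFin.symm.injective) (fun j => c (s.equivFin.symm j)) (by
      rw [← hc, ← Finset.sum_coe_sort s]
      exact Equiv.sum_comp s.equivFin.symm fun j : s => c j • f j)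
  have h2 := congr_fun h1 (s.equivFin ⟨i, hi⟩)
  simpa using h2

theorem linearIndependent_of_areDistinctComponents [∀ v w : V, Finite (v ⟶ w)]
    (hV : QuiverAcyclic V) {M : ModuleCat.{u} (PathAlgebra k V)}
    [Module.Finite (PathAlgebra k V) M] {ι : Type w} {T : ι → ModuleCat.{u} (PathAlgebra k V)}
    (hM : IsRigidModule k M) (hT : AreDistinctComponents k T M) :
    LinearIndependent ℝ (fun i => realGVector k (T i)) ∧
      LinearIndependent ℝ (fun (i : ι) (v : V) => (dimVector k (T i) v : ℝ)) := by
  have hk := module_finite k hV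
  choose N hN using hT.summand
  choose a r har using fun i => exists_retract_of_iso_biprod (hN i).some
  have hfin : ∀ i, Module.Finite (PathAlgebra k V) (T i) := fun i =>
    Module.Finite.of_surjective (r i) fun x => ⟨a i x, LinearMap.congr_fun (har i) x⟩
  have hfin' : ∀ i, Module.Finite k (T i) := fun i =>
    Module.Finite.trans (PathAlgebra k V) (T i)
  have hg : ∀ (n : ℕ) (e : Fin n → ι), Function.Injective e → ∀ c : Fin n → ℝ,
      ∑ i, c i • realGVector k (T (e i)) = 0 → c = 0 := fun n e he c hc =>
    eq_zero_of_sum_gVector_eq (T := fun i => T (e i)) (y := 0)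
      (fun i => hasPresentation_gVector hV (T (e i)))
      (fun i j => ExtVanish.of_isRigidModule hM _ _ (har _) _ _ (har _))
      (fun i => isIndecomposableModule_of_indecomposable (hT.indecomposable _))
      (fun i j hij => he (hT.pairwise_not_iso _ _ (hij.map LinearEquiv.toModuleIso)))
      (fun i v h => absurd rfl h) fun v => by
        have := congr_fun hc v
        simpa [realGVector] using this
  refine ⟨linearIndependent_fin_of_forall _ hg, linearIndependent_fin_of_forall _ ?_⟩
  intro n e he c hc
  refine hg n e he c (eq_zero_of_cartan (k := k) hV fun v => ?_)
  have h1 := congr_fun hc v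
  simp only [Finset.sum_apply, Pi.smul_apply, smul_eq_mul, Pi.zero_apply] at h1 ⊢
  have h2 : ∀ i, (dimVector k (T (e i)) v : ℝ) =
      ∑ w, realGVector k (T (e i)) w * (vdim k (vertexProjective k w) v : ℝ) := fun i => by
    have := (hasPresentation_gVector hV (T (e i))).vdim_eq (k := k) v
    rw [dimVector_eq_vdim]
    simp only [realGVector]
    exact_mod_cast this
  simp only [h2, Finset.mul_sum] at h1
  rw [Finset.sum_comm] at h1
  rw [← h1]
  refine Finset.sum_congr rfl fun w _ => ?_
  rw [Finset.sum_mul]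
  exact Finset.sum_congr rfl fun i _ => by ring

/-! ### Silting pairs -/

namespace SiltingPair

variable (S : SiltingPair k V)

theorem extVanish (i j : Fin S.m) : ExtVanish (PathAlgebra k V) (S.T i) (S.T j) := by
  classical
  exact ExtVanish.of_isRigidModule S.rigid
    (LinearMap.single (PathAlgebra k V) (fun i => S.T i) i) (LinearMap.proj i)
    (LinearMap.proj_comp_single_same _ _ _)
    (LinearMap.single (PathAlgebra k V) (fun i => S.T i) j) (LinearMap.proj j)
    (LinearMap.proj_comp_single_same _ _ _)

theorem vdim_eq_zero {v : V} (hv : v ∈ S.J) (i : Fin S.m) : vdim k (S.T i) v = 0 := by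
  classical
  have h := S.not_mem_support v hv
  rw [moduleSupport, Set.mem_ofPred_eq, not_not] at h
  have h1 : vspace k (S.T i) v = ⊥ := by
    rw [Submodule.eq_bot_iff]
    rintro _ ⟨x, rfl⟩
    have h2 := (Submodule.eq_bot_iff _).1 h _
      ⟨(Pi.single i x : ∀ i, S.T i), rfl⟩
    have h3 := congr_fun h2 i
    change idem k v • (Pi.single i x : ∀ i, S.T i) i = 0 at h3
    rwa [Pi.single_eq_same] at h3
  rw [vdim, h1, finrank_bot]

/-- The coefficient of `-e_v` in a combination of the `g`-vectors of the components. -/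
def shiftCoeff {S : SiltingPair k V} (c : Fin S.m ⊕ S.J → ℝ) (v : V) : ℝ :=
  open Classical in if h : v ∈ S.J then c (Sum.inr ⟨v, h⟩) else 0

variable {S}

theorem sum_smul_gVectors_apply (c : Fin S.m ⊕ S.J → ℝ) (v : V) :
    (∑ s, c s • S.gVectors s) v =
      ∑ i, c (Sum.inl i) * (gVector k (S.T i) v : ℝ) - shiftCoeff c v := by
  classical
  rw [Finset.sum_apply, Fintype.sum_sum_type, sub_eq_add_neg]
  congr 1
  have h1 : ∀ j : S.J, (c (Sum.inr j) • S.gVectors (Sum.inr j)) v =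
      if j.1 = v then -c (Sum.inr j) else 0 := fun j => by
    simp only [gVectors, Sum.elim_inr, shiftedGVector, Pi.smul_apply, Pi.neg_apply,
      Pi.single_apply, smul_eq_mul, eq_comm (a := v)]
    split_ifs <;> simp
  rw [Finset.sum_congr rfl fun j _ => h1 j, shiftCoeff]
  split_ifs with hv
  · rw [Finset.sum_eq_single ⟨v, hv⟩]
    · simp
    · intro j _ hj
      rw [if_neg fun h => hj (Subtype.ext h)]
    · simp
  · rw [neg_zero]
    refine Finset.sum_eq_zero fun j _ => ?_
    rw [if_neg fun h => hv (by rw [← h]; exact j.2)]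

theorem vdim_eq_zero_of_shiftCoeff_ne_zero {c : Fin S.m ⊕ S.J → ℝ} {v : V}
    (h : shiftCoeff c v ≠ 0) (i : Fin S.m) : vdim k (S.T i) v = 0 := by
  refine S.vdim_eq_zero ?_ i
  by_contra hv
  exact h (by rw [shiftCoeff, dif_neg hv])

theorem finite_T [∀ v w : V, Finite (v ⟶ w)] (hV : QuiverAcyclic V) (i : Fin S.m) :
    Module.Finite k (S.T i) :=
  have := module_finite k hV
  have := S.finite i
  Module.Finite.trans (PathAlgebra k V) (S.T i)

theorem linearIndependent_gVectors [∀ v w : V, Finite (v ⟶ w)] (hV : QuiverAcyclic V)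
    (S : SiltingPair k V) : LinearIndependent ℝ S.gVectors := by
  classical
  have hfin := finite_T (S := S) hV
  rw [Fintype.linearIndependent_iff]
  intro c hc
  have h0 : ∀ v, ∑ i, c (Sum.inl i) * (gVector k (S.T i) v : ℝ) = shiftCoeff c v := fun v => by
    have := congr_fun hc v
    rw [sum_smul_gVectors_apply, Pi.zero_apply] at this
    linarith
  have h1 := eq_zero_of_sum_gVector_eq (T := fun i => S.T i)
    (fun i => have := S.finite i; hasPresentation_gVector hV (S.T i)) S.extVanish
    (fun i => isIndecomposableModule_of_indecomposable (S.indecomposable i))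
    (fun i j hij => S.pairwise_not_iso _ _ (hij.map LinearEquiv.toModuleIso))
    (fun i v h => vdim_eq_zero_of_shiftCoeff_ne_zero h i) h0
  rintro (i | j)
  · exact congr_fun h1 i
  · have h2 := h0 j
    have h3 : ∀ i, c (Sum.inl i) = 0 := fun i => congr_fun h1 i
    simp only [h3, zero_mul, Finset.sum_const_zero, shiftCoeff, dif_pos j.2] at h2
    exact h2.symm

theorem isRigidCombination [∀ v w : V, Finite (v ⟶ w)] (hV : QuiverAcyclic V)
    {c : Fin S.m ⊕ S.J → ℝ} (hc : ∀ s, 0 ≤ c s) :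
    IsRigidCombination k (fun i : {i // 0 < c (Sum.inl i)} => S.T i)
      (fun i => gVector k (S.T i)) (fun i => c (Sum.inl i)) (shiftCoeff c)
      (∑ s, c s • S.gVectors s) where
  presentation i := have := S.finite i; hasPresentation_gVector hV (S.T i)
  ext i j := S.extVanish i j
  pos i := i.2
  nonneg v := by
    rw [shiftCoeff]
    split_ifs
    · exact hc _
    · exact le_rfl
  support i v hv := vdim_eq_zero_of_shiftCoeff_ne_zero hv i
  eq v := by
    classical
    rw [sum_smul_gVectors_apply]
    congr 1
    have h1 := Finset.sum_subtype_eq_sum_filter (s := Finset.univ)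
      (p := fun i => 0 < c (Sum.inl i)) (fun i => c (Sum.inl i) * (gVector k (S.T i) v : ℝ))
    rw [Finset.sum_filter_of_ne fun i _ hi => (hc _).lt_of_ne fun h => hi (by rw [← h, zero_mul])]
      at h1
    rw [← h1]
    exact Finset.sum_congr (by ext; simp) fun _ _ => rfl

/-- In two expressions of one vector as a nonnegative combination of `g`-vectors of silting pairs,
only common components occur. -/
theorem gVectors_mem_common [∀ v w : V, Finite (v ⟶ w)] (hV : QuiverAcyclic V)
    {c : Fin S.m ⊕ S.J → ℝ} (hc : ∀ s, 0 ≤ c s) {S' : SiltingPair k V}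
    {c' : Fin S'.m ⊕ S'.J → ℝ} (hc' : ∀ s, 0 ≤ c' s)
    (h : ∑ s, c s • S.gVectors s = ∑ s, c' s • S'.gVectors s) {s : Fin S.m ⊕ S.J}
    (hs : c s ≠ 0) : S.gVectors s ∈ S.commonGVectors S' := by
  have hfin := finite_T (S := S) hV
  have hfin' := finite_T (S := S') hV
  have h1 := isRigidCombination hV hc
  have h2 := isRigidCombination hV hc'
  rw [← h] at h2
  rcases s with i | j
  · obtain ⟨i', ⟨e⟩⟩ := h2.exists_linearEquiv h1
      (fun i => isIndecomposableModule_of_indecomposable (S'.indecomposable i))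
      (j := ⟨i, (hc _).lt_of_ne' hs⟩)
      (isIndecomposableModule_of_indecomposable (S.indecomposable i))
    exact Or.inl ⟨i, i', ⟨e.toModuleIso⟩, rfl⟩
  · right
    have h3 := h1.shift_eq h2
      (fun i => isIndecomposableModule_of_indecomposable (S.indecomposable i))
      (fun i => isIndecomposableModule_of_indecomposable (S'.indecomposable i))
      (fun i j hij => Subtype.ext (S.pairwise_not_iso _ _ (hij.map LinearEquiv.toModuleIso)))
      (fun i j ⟨e⟩ => gVector_congr e)
    refine ⟨j, j.2, ?_, rfl⟩
    have h4 := congr_fun h3 j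
    rw [shiftCoeff, dif_pos j.2] at h4
    by_contra hj
    rw [shiftCoeff, dif_neg hj] at h4
    exact hs h4

theorem commonGVectors_subset_left (S S' : SiltingPair k V) :
    S.commonGVectors S' ⊆ Set.range S.gVectors := by
  rintro x (⟨i, i', -, rfl⟩ | ⟨j, hj, -, rfl⟩)
  · exact ⟨Sum.inl i, rfl⟩
  · exact ⟨Sum.inr ⟨j, hj⟩, rfl⟩

theorem commonGVectors_subset_right (S S' : SiltingPair k V) :
    S.commonGVectors S' ⊆ Set.range S'.gVectors := by
  rintro x (⟨i, i', ⟨e⟩, rfl⟩ | ⟨j, -, hj, rfl⟩)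
  · exact ⟨Sum.inl i', congrArg (fun (f : V → ℤ) (v : V) => (f v : ℝ))
      (gVector_congr e.toLinearEquiv).symm⟩
  · exact ⟨Sum.inr ⟨j, hj⟩, rfl⟩

end SiltingPair

end Bridge

end

/-! ### Convex and conic combinations -/

section ConvexCombinations

variable {ι E : Type*} [Fintype ι] [AddCommGroup E] [Module ℝ E] {f : ι → E} {x : E}

theorem exists_of_mem_convexHull_range (hx : x ∈ convexHull ℝ (Set.range f)) :
    ∃ c : ι → ℝ, (∀ i, 0 ≤ c i) ∧ ∑ i, c i = 1 ∧ ∑ i, c i • f i = x := by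
  classical
  have h : convexHull ℝ (Set.range f) ⊆ Fintype.linearCombination ℝ f '' stdSimplex ℝ ι := by
    refine convexHull_min ?_ ((convex_stdSimplex ℝ ι).linear_image _)
    rintro _ ⟨i, rfl⟩
    exact ⟨Pi.single i 1, single_mem_stdSimplex ℝ i, by
      rw [Fintype.linearCombination_apply_single, one_smul]⟩
  obtain ⟨c, hc, rfl⟩ := h hx
  exact ⟨c, hc.1, hc.2, rfl⟩

theorem exists_of_mem_span_nnreal_range (hx : x ∈ Submodule.span NNReal (Set.range f)) :
    ∃ c : ι → ℝ, (∀ i, 0 ≤ c i) ∧ ∑ i, c i • f i = x := by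
  obtain ⟨c, rfl⟩ := (Submodule.mem_span_range_iff_exists_fun _).1 hx
  exact ⟨fun i => c i, fun i => (c i).2, rfl⟩

theorem sum_smul_mem_convexHull {s : Set E} {c : ι → ℝ} (hc : ∀ i, 0 ≤ c i) (hc1 : ∑ i, c i = 1)
    (hs : ∀ i, c i ≠ 0 → f i ∈ s) : ∑ i, c i • f i ∈ convexHull ℝ s := by
  classical
  have h : ∑ i with c i ≠ 0, c i • f i = ∑ i, c i • f i :=
    Finset.sum_filter_of_ne fun i _ hi h0 => hi (by rw [h0, zero_smul])
  rw [← h]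
  refine (convex_convexHull ℝ s).sum_mem (fun i _ => hc i) ?_ fun i hi =>
    subset_convexHull ℝ s (hs i (Finset.mem_filter.1 hi).2)
  rw [← hc1]
  exact Finset.sum_filter_of_ne fun i _ hi => hi

theorem sum_smul_mem_span_nnreal {s : Set E} {c : ι → ℝ} (hc : ∀ i, 0 ≤ c i)
    (hs : ∀ i, c i ≠ 0 → f i ∈ s) : ∑ i, c i • f i ∈ Submodule.span NNReal s := by
  refine Submodule.sum_mem _ fun i _ => ?_
  by_cases h : c i = 0
  · rw [h, zero_smul]
    exact Submodule.zero_mem _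
  · exact Submodule.smul_mem _ (⟨c i, hc i⟩ : NNReal) (Submodule.subset_span (hs i h))

end ConvexCombinations

theorem mainTheorem5 (k : Type u) [Field k] [IsAlgClosed k] (V : Type u) [Quiver.{u} V]
    [Fintype V] [∀ v w : V, Finite (v ⟶ w)] (hV : QuiverAcyclic V) :
    (∀ (M : ModuleCat.{u} (PathAlgebra k V)) [Module.Finite (PathAlgebra k V) M]
        {ι : Type w} (T : ι → ModuleCat.{u} (PathAlgebra k V)),
        IsRigidModule k M → AreDistinctComponents k T M →
          LinearIndependent ℝ (fun i => realGVector k (T i)) ∧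
          LinearIndependent ℝ (fun (i : ι) (v : V) => (dimVector k (T i) v : ℝ)) ∧
          Finite ι ∧ Nat.card ι ≤ Fintype.card V) ∧
    (∀ S : SiltingPair k V,
        Nat.card (Fin S.m ⊕ S.J) = Fintype.card V ∧
        LinearIndependent ℝ S.gVectors ∧ AffineIndependent ℝ S.gVectors) ∧
    (∀ S S' : SiltingPair k V,
        convexHull ℝ (Set.range S.gVectors) ∩ convexHull ℝ (Set.range S'.gVectors) =
          convexHull ℝ (S.commonGVectors S') ∧
        (Submodule.span NNReal (Set.range S.gVectors) : Set (V → ℝ)) ∩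
            Submodule.span NNReal (Set.range S'.gVectors) =
          Submodule.span NNReal (S.commonGVectors S')) := by
  refine ⟨fun M _ ι T hM hT => ?_, fun S => ?_, fun S S' => ⟨?_, ?_⟩⟩
  · obtain ⟨h1, h2⟩ := linearIndependent_of_areDistinctComponents hV hM hT
    have : Finite ι := h1.finite
    refine ⟨h1, h2, this, ?_⟩
    have := Fintype.ofFinite ι
    rw [Nat.card_eq_fintype_card]
    exact h1.fintype_card_le_finrank.trans_eq (Module.finrank_fintype_fun_eq_card ℝ)
  · have h := SiltingPair.linearIndependent_gVectors hV S
    refine ⟨?_, h, h.affineIndependent⟩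
    rw [Nat.card_eq_fintype_card, Fintype.card_sum, Fintype.card_fin, Fintype.card_coe, add_comm]
    exact S.card_J
  · refine Set.Subset.antisymm ?_ (Set.subset_inter
      (convexHull_mono (S.commonGVectors_subset_left S'))
      (convexHull_mono (S.commonGVectors_subset_right S')))
    rintro x ⟨hx, hx'⟩
    obtain ⟨c, hc, hc1, rfl⟩ := exists_of_mem_convexHull_range hx
    obtain ⟨c', hc', -, h⟩ := exists_of_mem_convexHull_range hx'
    exact sum_smul_mem_convexHull hc hc1 fun s =>
      SiltingPair.gVectors_mem_common hV hc hc' h.symm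
  · refine Set.Subset.antisymm ?_ (Set.subset_inter
      (Submodule.span_mono (S.commonGVectors_subset_left S'))
      (Submodule.span_mono (S.commonGVectors_subset_right S')))
    rintro x ⟨hx, hx'⟩
    obtain ⟨c, hc, rfl⟩ := exists_of_mem_span_nnreal_range hx
    obtain ⟨c', hc', h⟩ := exists_of_mem_span_nnreal_range hx'
    exact sum_smul_mem_span_nnreal hc fun s =>
      SiltingPair.gVectors_mem_common hV hc hc' h.symm
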